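/- An ordered graph is a finite simple graph with a linear order on its vertices; ordered graphs are considered up to order-preserving isomorphism. An ordered graph $H$ contains an ordered graph $G$ if some (not necessarily induced) subgraph of $H$, with the inherited vertex order, is isomorphic to $G$ by an order-preserving isomorphism. Let $\mathrm{ex}_<(n,G)$ be the maximum number of edges of an ordered graph on $n$ vertices that does not contain $G$. Call $G$ minimally non-linear if $\mathrm{ex}_<(n,G)=\omega(n)$, but $\mathrm{ex}_<(n,G')=O(n)$ for every $G'$ that is contained in $G$ and not equal to $G$. An ordered graph is bipartite if its vertices split into two parts such that all vertices of the first part precede all vertices of the second part and every edge joins the two parts. Let $k$ be a natural number. 1. Every minimally non-linear bipartite ordered graph with $k$ vertices in one part (the first or the second) has at most $4k-4$ edges. 2. Every minimally non-linear bipartite ordered graph with $k$ vertices in one part (the first or the second) has at most $4k-4$ vertices in the other part. 3. If $k>2$, then the number of minimally non-linear bipartite ordered graphs with $k$ vertices in one part (that is, in the first part or in the second part) is finite and at most $$\sum_{i=\lceil (k+4)/4\rceil}^{4k-4}\bigl(i^k-(i-1)^k\bigr)k^{i-1}.$$ -/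

import Mathlib

open Filter Asymptotics

/-- A finite ordered graph: a simple graph on the linearly ordered vertex set `0 < 1 < ... < order - 1`.
Every finite simple graph with a linear order on its vertices is isomorphic, as an ordered graph,
to exactly one of these, so equality is the same as isomorphism of ordered graphs. -/
structure OrderedGraph where
  order : ℕ
  graph : SimpleGraph (Fin order)

namespace OrderedGraph

/-- The number of edges. -/
noncomputable def numEdges (G : OrderedGraph) : ℕ := G.graph.edgeSet.ncard

/-- `H` contains `G`: some (not necessarily induced) ordered subgraph of `H` is isomorphic to `G`
by an order-preserving isomorphism. -/
def Contains (H G : OrderedGraph) : Prop :=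
  ∃ f : Fin G.order ↪o Fin H.order, ∀ u v, G.graph.Adj u v → H.graph.Adj (f u) (f v)

/-- `ex_<(n, G)`: the maximum number of edges of an ordered graph on `n` vertices that does not
contain `G` (and `0` if there is no such ordered graph). -/
noncomputable def ex (n : ℕ) (G : OrderedGraph) : ℕ :=
  sSup {m | ∃ H : OrderedGraph, H.order = n ∧ ¬ H.Contains G ∧ H.numEdges = m}

/-- `ex_<(n, G) = O(n)`. -/
def IsLinear (G : OrderedGraph) : Prop :=
  (fun n : ℕ => (ex n G : ℝ)) =O[atTop] (fun n : ℕ => (n : ℝ))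

/-- `ex_<(n, G) = ω(n)`. -/
def IsNonlinear (G : OrderedGraph) : Prop :=
  (fun n : ℕ => (n : ℝ)) =o[atTop] (fun n : ℕ => (ex n G : ℝ))

/-- `ex_<(n, G) = ω(n)`, but `ex_<(n, G') = O(n)` for every `G'` that is contained in `G` and
not equal to `G`. -/
def IsMinimallyNonlinear (G : OrderedGraph) : Prop :=
  G.IsNonlinear ∧ ∀ G' : OrderedGraph, G.Contains G' → G' ≠ G → G'.IsLinear

/-- The first `a` vertices and the remaining `b` vertices are the two parts of a bipartite ordered
graph: every edge joins a vertex of the first part to a vertex of the second part. -/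
def IsBipartiteSplit (G : OrderedGraph) (a b : ℕ) : Prop :=
  G.order = a + b ∧
    ∀ u v : Fin G.order, u < v → G.graph.Adj u v → (u : ℕ) < a ∧ a ≤ (v : ℕ)

/-- `G` is a bipartite ordered graph with `k` vertices in one part (the first or the second) and
`l` vertices in the other part. -/
def HasParts (G : OrderedGraph) (k l : ℕ) : Prop :=
  G.IsBipartiteSplit k l ∨ G.IsBipartiteSplit l k

end OrderedGraph

/-! Let `G` be minimally non-linear and bipartite. Reversing the order if necessary, its `k`
vertices come first. Regard the edges as entries of a matrix with `k` rows (first part) and `l`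
columns (second part).

Forbidden patterns: `zigzag` and `interleaved` are themselves not linear, the former by a
powers-of-two construction, the latter by a double recursion. Hence `G` contains neither, unless it
equals one of them and has three edges. So if a row has entries in columns `a < c`, no later row has
an entry in a column of `(a, c]`.

Redundancy: suppose deleting a column leaves a graph with a linear bound, and any host can be
thinned, up to a constant factor and `O(n)` edges, so that every copy of the smaller graph in the
thinned host extends to a copy of `G` in the original one. Then `G` is linear. Consequently no
column is empty. Nor can a column have a single entry when that entry is the middle of three
consecutive ones in its row, or lies in the last column with the entry before it also present, or
lies in the last row and first column with the entry after it also present.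

Counting (`card_le_of_irredundant`): at most `k` entries are first in their row. The others occupy
distinct columns and split into three classes of sizes at most `k - 1`, `k` and `k - 1`. The two
ends of the matrix save two more, leaving `4k - 4`. No column is empty, so `l` has the same bound.

Enumeration: `G` is determined by the list of its column sets, which are non-empty and of total size
at most `4k - 4`. There are at most `(3k/2)^e` lists of total size `e`. Summing over `e` and
doubling for the two orientations stays below the required sum. -/

namespace OrderedGraph

/-! ### Edge sets as increasing pairs, and linear bounds -/

/-- `E` is the edge set, written as increasing pairs, of a graph on `0, …, n - 1`. -/
def IsHost (n : ℕ) (E : Finset (ℕ × ℕ)) : Prop := ∀ p ∈ E, p.1 < p.2 ∧ p.2 < n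

/-- The graph on `0, …, n - 1` with edge set `E` contains `G`. -/
def EmbedsIn (G : OrderedGraph) (n : ℕ) (E : Finset (ℕ × ℕ)) : Prop :=
  ∃ f : Fin G.order → ℕ, StrictMono f ∧ (∀ u, f u < n) ∧
    ∀ u v, u < v → G.graph.Adj u v → (f u, f v) ∈ E

/-- Graphs on `n` vertices avoiding `G` have at most `C * (n + 1)` edges. -/
def HasLinearBound (G : OrderedGraph) : Prop :=
  ∃ C : ℕ, ∀ n E, IsHost n E → ¬ G.EmbedsIn n E → E.card ≤ C * (n + 1)

open Classical in
/-- The edges as increasing pairs of natural numbers. -/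
noncomputable def edgePairs (G : OrderedGraph) : Finset (ℕ × ℕ) :=
  (Finset.univ.filter fun p : Fin G.order × Fin G.order => p.1 < p.2 ∧ G.graph.Adj p.1 p.2).image
    fun p => ((p.1 : ℕ), (p.2 : ℕ))

theorem mem_edgePairs {G : OrderedGraph} {u v : Fin G.order} :
    ((u : ℕ), (v : ℕ)) ∈ G.edgePairs ↔ u < v ∧ G.graph.Adj u v := by
  simp only [edgePairs, Finset.mem_image, Finset.mem_filter, Finset.mem_univ, true_and,
    Prod.mk.injEq, Prod.exists]
  constructor
  · rintro ⟨a, b, h, ha, hb⟩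
    rw [Fin.val_inj] at ha hb
    subst ha hb
    exact h
  · exact fun h => ⟨u, v, h, rfl, rfl⟩

theorem exists_of_mem_edgePairs {G : OrderedGraph} {p : ℕ × ℕ} (h : p ∈ G.edgePairs) :
    ∃ u v : Fin G.order, u < v ∧ G.graph.Adj u v ∧ p = ((u : ℕ), (v : ℕ)) := by
  simp only [edgePairs, Finset.mem_image, Finset.mem_filter, Finset.mem_univ, true_and,
    Prod.exists] at h
  obtain ⟨a, b, h, rfl⟩ := h
  exact ⟨a, b, h.1, h.2, rfl⟩

theorem isHost_edgePairs (G : OrderedGraph) : IsHost G.order G.edgePairs := by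
  intro p hp
  obtain ⟨u, v, huv, -, rfl⟩ := exists_of_mem_edgePairs hp
  exact ⟨huv, v.2⟩

theorem numEdges_eq_card (G : OrderedGraph) : G.numEdges = G.edgePairs.card := by
  classical
  rw [edgePairs, Finset.card_image_of_injective, numEdges]
  · have : G.graph.edgeSet = (fun p : Fin G.order × Fin G.order => s(p.1, p.2)) ''
        ((Finset.univ.filter fun p : Fin G.order × Fin G.order =>
          p.1 < p.2 ∧ G.graph.Adj p.1 p.2 : Finset _) : Set _) := by
      ext e
      induction e with | _ a b
      simp only [SimpleGraph.mem_edgeSet, Finset.coe_filter, Finset.mem_univ, true_and,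
        Set.mem_image, Set.mem_ofPred_eq, Prod.exists]
      constructor
      · intro h
        rcases lt_or_gt_of_ne h.ne with hab | hab
        · exact ⟨a, b, ⟨hab, h⟩, rfl⟩
        · exact ⟨b, a, ⟨hab, h.symm⟩, Sym2.eq_swap⟩
      · rintro ⟨x, y, ⟨-, h⟩, he⟩
        rw [Sym2.eq_iff] at he
        rcases he with ⟨rfl, rfl⟩ | ⟨rfl, rfl⟩
        · exact h
        · exact h.symm
    rw [this, Set.InjOn.ncard_image, Set.ncard_coe_finset]
    rintro ⟨a, b⟩ hab ⟨c, d⟩ hcd h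
    simp only [Finset.coe_filter, Finset.mem_univ, true_and, Set.mem_ofPred_eq] at hab hcd
    simp only [Sym2.eq_iff] at h
    rcases h with ⟨rfl, rfl⟩ | ⟨rfl, rfl⟩
    · rfl
    · exact absurd hab.1 hcd.1.not_gt
  · rintro ⟨a, b⟩ ⟨c, d⟩ h
    simpa [Fin.val_inj] using h

theorem contains_iff_embedsIn {H G : OrderedGraph} :
    H.Contains G ↔ G.EmbedsIn H.order H.edgePairs := by
  constructor
  · rintro ⟨f, hf⟩
    exact ⟨fun u => f u, fun u v h => f.strictMono h, fun u => (f u).2,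
      fun u v huv h => mem_edgePairs.2 ⟨f.strictMono huv, hf u v h⟩⟩
  · rintro ⟨f, hf, hn, h⟩
    refine ⟨OrderEmbedding.ofStrictMono (fun u => ⟨f u, hn u⟩) fun u v huv => hf huv, ?_⟩
    intro u v huv
    rcases lt_or_gt_of_ne huv.ne with hlt | hlt
    · exact ((mem_edgePairs (G := H) (u := ⟨f u, hn u⟩) (v := ⟨f v, hn v⟩)).1 (h u v hlt huv)).2
    · exact ((mem_edgePairs (G := H) (u := ⟨f v, hn v⟩) (v := ⟨f u, hn u⟩)).1 (h v u hlt huv.symm)).2.symm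

/-- The ordered graph on `0, …, n - 1` with edge set `E`. -/
def ofPairs (n : ℕ) (E : Finset (ℕ × ℕ)) : OrderedGraph :=
  ⟨n, SimpleGraph.fromRel fun u v : Fin n => ((u : ℕ), (v : ℕ)) ∈ E⟩

theorem edgePairs_ofPairs {n : ℕ} {E : Finset (ℕ × ℕ)} (hE : IsHost n E) :
    (ofPairs n E).edgePairs = E := by
  ext p
  constructor
  · intro h
    obtain ⟨u, v, huv, hadj, rfl⟩ := exists_of_mem_edgePairs h
    rcases hadj.2 with h | h
    · exact h
    · exact absurd (hE _ h).1 huv.le.not_gt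
  · intro h
    obtain ⟨h1, h2⟩ := hE p h
    exact mem_edgePairs (G := ofPairs n E) (u := ⟨p.1, h1.trans h2⟩) (v := ⟨p.2, h2⟩) |>.2
      ⟨h1, fun he => h1.ne (Fin.mk.inj he), Or.inl h⟩

theorem IsHost.card_le {n : ℕ} {E : Finset (ℕ × ℕ)} (hE : IsHost n E) : E.card ≤ n * n := by
  calc E.card ≤ (Finset.range n ×ˢ Finset.range n).card := by
        refine Finset.card_le_card fun p hp => ?_
        obtain ⟨h1, h2⟩ := hE p hp
        simpa using ⟨h1.trans h2, h2⟩
    _ = n * n := by simp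

theorem numEdges_le_sq (G : OrderedGraph) : G.numEdges ≤ G.order * G.order := by
  rw [numEdges_eq_card]
  exact G.isHost_edgePairs.card_le

theorem numEdges_le_ex {G H : OrderedGraph} (h : ¬ H.Contains G) : H.numEdges ≤ ex H.order G := by
  refine le_csSup ⟨H.order * H.order, ?_⟩ ⟨H, rfl, h, rfl⟩
  rintro m ⟨H', ho, -, rfl⟩
  rw [← ho]
  exact H'.numEdges_le_sq

theorem card_le_ex {G : OrderedGraph} {n : ℕ} {E : Finset (ℕ × ℕ)} (hE : IsHost n E)
    (h : ¬ G.EmbedsIn n E) : E.card ≤ ex n G := by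
  have := numEdges_le_ex (G := G) (H := ofPairs n E)
    (by rwa [contains_iff_embedsIn, edgePairs_ofPairs hE])
  rwa [numEdges_eq_card, edgePairs_ofPairs hE] at this

theorem IsLinear.hasLinearBound {G : OrderedGraph} (h : G.IsLinear) : G.HasLinearBound := by
  obtain ⟨c, hc⟩ := isBigO_iff.1 h
  obtain ⟨N, hN⟩ := eventually_atTop.1 hc
  refine ⟨max ⌈c⌉₊ N, fun n E hE hG => ?_⟩
  rcases lt_or_ge n N with hn | hn
  · calc E.card ≤ n * n := hE.card_le
      _ ≤ max ⌈c⌉₊ N * (n + 1) :=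
        Nat.mul_le_mul (hn.le.trans (le_max_right _ _)) n.le_succ
  · have h1 := hN n hn
    simp only [Real.norm_natCast] at h1
    have h2 : (ex n G : ℝ) ≤ (⌈c⌉₊ * n : ℕ) := by
      push_cast
      exact h1.trans (mul_le_mul_of_nonneg_right (Nat.le_ceil c) (Nat.cast_nonneg n))
    calc E.card ≤ ex n G := card_le_ex hE hG
      _ ≤ ⌈c⌉₊ * n := by exact_mod_cast h2
      _ ≤ _ := Nat.mul_le_mul (le_max_left _ _) n.le_succ

theorem HasLinearBound.not_isNonlinear {G : OrderedGraph} (h : G.HasLinearBound) :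
    ¬ G.IsNonlinear := by
  obtain ⟨C, hC⟩ := h
  intro hG
  have h0 : (0 : ℝ) < 1 / (2 * (C + 1)) := by positivity
  obtain ⟨N, hN⟩ := eventually_atTop.1 (isLittleO_iff.1 hG h0)
  have h1 := hN (max N 2) (le_max_left _ _)
  set n := max N 2 with hn
  have h2 : (2 : ℝ) ≤ n := by exact_mod_cast le_max_right N 2
  have h3 : ex n G ≤ C * (n + 1) := by
    refine csSup_le' ?_
    rintro m ⟨H, ho, hH, rfl⟩
    rw [numEdges_eq_card, ← ho]
    exact hC _ _ H.isHost_edgePairs (by rwa [← contains_iff_embedsIn])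
  have h4 : (ex n G : ℝ) ≤ C * (n + 1) := by exact_mod_cast h3
  simp only [Real.norm_natCast] at h1
  rw [div_mul_eq_mul_div, le_div_iff₀ (by positivity)] at h1
  nlinarith [(Nat.cast_nonneg C : (0 : ℝ) ≤ C)]

/-- The linear bound for hosts whose vertices are an arbitrary finite set of natural numbers. -/
theorem HasLinearBound.card_le_of_subset {G : OrderedGraph} (h : G.HasLinearBound) :
    ∃ C : ℕ, ∀ (V : Finset ℕ) (E : Finset (ℕ × ℕ)),
      (∀ p ∈ E, p.1 < p.2 ∧ p.1 ∈ V ∧ p.2 ∈ V) →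
      (¬ ∃ f : Fin G.order → ℕ, StrictMono f ∧ ∀ u v, u < v → G.graph.Adj u v → (f u, f v) ∈ E) →
      E.card ≤ C * (V.card + 1) := by
  obtain ⟨C, hC⟩ := h
  refine ⟨C, fun V E hE hG => ?_⟩
  -- Ranks within `V` carry the host order-isomorphically onto an initial segment.
  set rk : ℕ → ℕ := fun x => (V.filter (· < x)).card with hrk
  have hlt : ∀ x ∈ V, ∀ y, x < y → rk x < rk y := by
    intro x hx y hxy
    refine Finset.card_lt_card ⟨fun z hz => ?_, fun hsub => ?_⟩
    · simp only [Finset.mem_filter] at hz ⊢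
      exact ⟨hz.1, hz.2.trans hxy⟩
    · have := hsub (Finset.mem_filter.2 ⟨hx, hxy⟩)
      simp at this
  have hmono : ∀ x ∈ V, ∀ y ∈ V, rk x < rk y → x < y := by
    intro x hx y hy hxy
    by_contra hle
    rcases (not_lt.1 hle).eq_or_lt with h | h
    · subst h; exact lt_irrefl _ hxy
    · exact absurd (hlt y hy x h) hxy.not_gt
  have hinj : ∀ x ∈ V, ∀ y ∈ V, rk x = rk y → x = y := by
    intro x hx y hy hxy
    rcases lt_trichotomy x y with h | h | h
    · exact absurd hxy (hlt x hx y h).ne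
    · exact h
    · exact absurd hxy (hlt y hy x h).ne'
  have hlt' : ∀ x ∈ V, rk x < V.card := fun x hx =>
    Finset.card_lt_card ⟨Finset.filter_subset _ _, fun hsub => by
      have := hsub hx
      simp at this⟩
  have hsurj : ∀ i < V.card, ∃ x ∈ V, rk x = i := by
    have himg : V.image rk = Finset.range V.card := by
      refine Finset.eq_of_subset_of_card_le (fun i hi => ?_) ?_
      · obtain ⟨x, hx, rfl⟩ := Finset.mem_image.1 hi
        exact Finset.mem_range.2 (hlt' x hx)
      · rw [Finset.card_range, Finset.card_image_of_injOn fun x hx y hy => hinj x hx y hy]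
    intro i hi
    have : i ∈ V.image rk := himg ▸ Finset.mem_range.2 hi
    simpa using this
  have hcard : (E.image fun p => (rk p.1, rk p.2)).card = E.card := by
    refine Finset.card_image_of_injOn fun p hp q hq hpq => ?_
    simp only [Prod.mk.injEq] at hpq
    exact Prod.ext (hinj _ (hE p hp).2.1 _ (hE q hq).2.1 hpq.1)
      (hinj _ (hE p hp).2.2 _ (hE q hq).2.2 hpq.2)
  rw [← hcard]
  refine hC _ _ (fun p hp => ?_) ?_
  · obtain ⟨q, hq, rfl⟩ := Finset.mem_image.1 hp
    exact ⟨hlt _ (hE q hq).2.1 _ (hE q hq).1, hlt' _ (hE q hq).2.2⟩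
  · rintro ⟨f, hf, hfn, hfE⟩
    choose g hgV hg using fun u => hsurj (f u) (hfn u)
    refine hG ⟨g, fun u v huv => hmono _ (hgV u) _ (hgV v) (by rw [hg, hg]; exact hf huv), ?_⟩
    intro u v huv hadj
    obtain ⟨q, hq, hqe⟩ := Finset.mem_image.1 (hfE u v huv hadj)
    simp only [Prod.mk.injEq] at hqe
    have h1 : q.1 = g u := hinj _ (hE q hq).2.1 _ (hgV u) (by rw [hg]; exact hqe.1)
    have h2 : q.2 = g v := hinj _ (hE q hq).2.2 _ (hgV v) (by rw [hg]; exact hqe.2)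
    rw [← h1, ← h2]
    exact hq

/-! ### Reversal of the vertex order -/

/-- The graph with the order of its vertices reversed. -/
def reverse (G : OrderedGraph) : OrderedGraph := ⟨G.order, G.graph.comap Fin.rev⟩

theorem reverse_reverse (G : OrderedGraph) : G.reverse.reverse = G := by
  obtain ⟨n, g⟩ := G
  simp only [reverse, mk.injEq, heq_eq_eq, true_and]
  ext u v
  simp

theorem Contains.reverse {H G : OrderedGraph} (h : H.Contains G) : H.reverse.Contains G.reverse := by
  obtain ⟨f, hf⟩ := h
  refine ⟨OrderEmbedding.ofStrictMono (fun u : Fin G.order => (f u.rev).rev)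
    (fun u v huv => ?_), fun u v huv => ?_⟩
  · exact Fin.rev_lt_rev.2 (f.strictMono (Fin.rev_lt_rev.2 huv))
  · change H.graph.Adj (f u.rev).rev.rev (f v.rev).rev.rev
    rw [Fin.rev_rev, Fin.rev_rev]
    exact hf _ _ huv

theorem numEdges_reverse (G : OrderedGraph) : G.reverse.numEdges = G.numEdges := by
  have key : ∀ G : OrderedGraph, G.numEdges ≤ G.reverse.numEdges := by
    intro G
    rw [numEdges_eq_card, numEdges_eq_card]
    refine Finset.card_le_card_of_injOn (fun p => (G.order - 1 - p.2, G.order - 1 - p.1))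
      (fun p hp => ?_) fun p hp q hq h => ?_
    · obtain ⟨u, v, huv, h, rfl⟩ := exists_of_mem_edgePairs hp
      have := mem_edgePairs (G := G.reverse) (u := v.rev) (v := u.rev) |>.2
        ⟨Fin.rev_lt_rev.2 huv, by simpa [reverse] using h.symm⟩
      have e : ∀ w : Fin G.order, ((Fin.rev w : Fin G.order) : ℕ) = G.order - 1 - w := by
        intro w; simp only [Fin.val_rev]; omega
      have e1 := e u
      have e2 := e v
      simp only [← e1, ← e2]
      exact this
    · have h1 := G.isHost_edgePairs p hp
      have h2 := G.isHost_edgePairs q hq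
      simp only [Prod.mk.injEq] at h
      ext <;> omega
  exact le_antisymm (by simpa [reverse_reverse] using key G.reverse) (key G)

theorem ex_reverse (n : ℕ) (G : OrderedGraph) : ex n G.reverse = ex n G := by
  have key : ∀ G : OrderedGraph,
      {m | ∃ H : OrderedGraph, H.order = n ∧ ¬ H.Contains G ∧ H.numEdges = m} ⊆
      {m | ∃ H : OrderedGraph, H.order = n ∧ ¬ H.Contains G.reverse ∧ H.numEdges = m} := by
    rintro G m ⟨H, hn, hH, rfl⟩
    refine ⟨H.reverse, hn, fun h => hH ?_, numEdges_reverse H⟩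
    simpa [reverse_reverse] using h.reverse
  have h2 := key G.reverse
  rw [reverse_reverse] at h2
  rw [ex, ex, subset_antisymm (key G) h2]

theorem IsMinimallyNonlinear.reverse {G : OrderedGraph} (h : G.IsMinimallyNonlinear) :
    G.reverse.IsMinimallyNonlinear := by
  refine ⟨?_, fun G' hG' hne => ?_⟩
  · have := h.1
    simpa only [IsNonlinear, ex_reverse] using this
  · have := h.2 G'.reverse (by simpa [reverse_reverse] using hG'.reverse) (fun he => hne (by
      rw [← he, reverse_reverse]))
    simpa only [IsLinear, ex_reverse] using this

theorem IsBipartiteSplit.reverse {G : OrderedGraph} {a b : ℕ} (h : G.IsBipartiteSplit a b) :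
    G.reverse.IsBipartiteSplit b a := by
  refine ⟨h.1.trans (add_comm a b), fun u v huv hadj => ?_⟩
  have : G.order - ((v : ℕ) + 1) < a ∧ a ≤ G.order - ((u : ℕ) + 1) := h.2 (Fin.rev v) (Fin.rev u) (Fin.rev_lt_rev.2 huv) hadj.symm
  have ho := h.1
  have h1 : (v : ℕ) < G.order := v.2
  have h2 : (u : ℕ) < G.order := u.2
  omega

/-! ### Deleting a vertex of degree one and restoring it -/

theorem val_succAbove {m : ℕ} (c : Fin (m + 1)) (i : Fin m) :
    (c.succAbove i : ℕ) = if (i : ℕ) < c then (i : ℕ) else i + 1 := by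
  simp only [Fin.succAbove, Fin.lt_def, Fin.val_castSucc]
  split_ifs <;> simp

theorem strictMono_insertNth' {m : ℕ} (c : Fin (m + 1)) {f : Fin m → ℕ} (hf : StrictMono f) {x : ℕ}
    (h1 : ∀ i : Fin m, (i : ℕ) < c → f i < x) (h2 : ∀ i : Fin m, (c : ℕ) ≤ i → x < f i) :
    StrictMono (Fin.insertNth (α := fun _ => ℕ) c x f) := by
  intro u v huv
  rcases Fin.eq_self_or_eq_succAbove c u with rfl | ⟨i, rfl⟩
  · rcases Fin.eq_self_or_eq_succAbove u v with rfl | ⟨j, rfl⟩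
    · exact absurd huv (lt_irrefl _)
    · simp only [Fin.insertNth_apply_same, Fin.insertNth_apply_succAbove]
      refine h2 j ?_
      rw [Fin.lt_def, val_succAbove] at huv
      split_ifs at huv <;> omega
  · rcases Fin.eq_self_or_eq_succAbove c v with rfl | ⟨j, rfl⟩
    · simp only [Fin.insertNth_apply_same, Fin.insertNth_apply_succAbove]
      refine h1 i ?_
      rw [Fin.lt_def, val_succAbove] at huv
      split_ifs at huv <;> omega
    · simp only [Fin.insertNth_apply_succAbove]
      exact hf (by simpa using huv)

/-- The ordered graph without its vertex `c`. -/
def deleteVertex {m : ℕ} (g : SimpleGraph (Fin (m + 1))) (c : Fin (m + 1)) : OrderedGraph :=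
  ⟨m, g.comap c.succAbove⟩

theorem IsMinimallyNonlinear.hasLinearBound_deleteVertex {m : ℕ} {g : SimpleGraph (Fin (m + 1))}
    (h : IsMinimallyNonlinear ⟨m + 1, g⟩) (c : Fin (m + 1)) : (deleteVertex g c).HasLinearBound := by
  refine (h.2 _ ⟨Fin.succAboveOrderEmb c, fun u v huv => huv⟩ fun he => ?_).hasLinearBound
  have := congrArg OrderedGraph.order he
  simp [deleteVertex] at this

/-- A host avoiding `G` thins to `E'`, which must avoid `G` without `c`, since a copy there extends
by the vertex `x`. Minimality then bounds `E'`, hence `E`, linearly. -/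
theorem IsMinimallyNonlinear.false_of_pendant {m : ℕ} {g : SimpleGraph (Fin (m + 1))}
    (h : IsMinimallyNonlinear ⟨m + 1, g⟩) (c : Fin (m + 1)) (r : Fin m) (hr : (r : ℕ) < c)
    (honly : ∀ u, g.Adj u c → u = c.succAbove r)
    (red : ∀ n E, IsHost n E → ∃ E' ⊆ E, E.card ≤ 2 * E'.card + n ∧ ∀ f : Fin m → ℕ, StrictMono f →
      (∀ u v, u < v → g.Adj (c.succAbove u) (c.succAbove v) → (f u, f v) ∈ E') →
      ∃ x, (f r, x) ∈ E ∧ (∀ i : Fin m, (i : ℕ) < c → f i < x) ∧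
        ∀ i : Fin m, (c : ℕ) ≤ i → x < f i) : False := by
  obtain ⟨C, hC⟩ := h.hasLinearBound_deleteVertex c
  refine HasLinearBound.not_isNonlinear ⟨2 * C + 1, fun n E hE hG => ?_⟩ h.1
  obtain ⟨E', hE', hcard, hext⟩ := red n E hE
  have := hC n E' (fun p hp => hE p (hE' hp)) ?_
  · calc E.card ≤ 2 * E'.card + n := hcard
      _ ≤ 2 * (C * (n + 1)) + n := by gcongr
      _ ≤ (2 * C + 1) * (n + 1) := by ring_nf; omega
  · rintro ⟨(f : Fin m → ℕ), hf, hfn, hfE⟩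
    obtain ⟨x, hxE, hx1, hx2⟩ := hext f hf hfE
    have hmono := strictMono_insertNth' c hf hx1 hx2
    refine hG ⟨_, hmono, fun (u : Fin (m + 1)) => ?_, fun (u v : Fin (m + 1)) huv hadj => ?_⟩
    · rcases Fin.eq_self_or_eq_succAbove c u with rfl | ⟨i, rfl⟩
      · simpa using (hE _ hxE).2
      · simpa using hfn i
    · rcases Fin.eq_self_or_eq_succAbove c u with rfl | ⟨i, rfl⟩
      · have h1 := honly v hadj.symm
        subst h1
        rw [Fin.lt_def, val_succAbove, if_pos hr] at huv
        omega
      · rcases Fin.eq_self_or_eq_succAbove c v with rfl | ⟨j, rfl⟩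
        · have h1 := Fin.succAbove_right_injective (honly _ hadj)
          subst h1
          simpa using hxE
        · simp only [Fin.insertNth_apply_succAbove]
          exact hE' (hfE i j (Fin.succAbove_lt_succAbove_iff.1 huv) hadj)

/-- Number the edges at each left endpoint from left to right and keep the larger parity class. Two
kept edges at one left endpoint have ranks differing by at least two, so an edge of `E` lies between
them. The term `n` only matches the shape of the two lemmas that follow. -/
theorem exists_alternate (n : ℕ) (E : Finset (ℕ × ℕ)) : ∃ E' ⊆ E, E.card ≤ 2 * E'.card + n ∧
    ∀ v w w', w < w' → (v, w) ∈ E' → (v, w') ∈ E' → ∃ x, w < x ∧ x < w' ∧ (v, x) ∈ E := by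
  set rk : ℕ × ℕ → ℕ := fun p => (E.filter fun q => q.1 = p.1 ∧ q.2 < p.2).card with hrk
  have key : ∀ b : ℕ, ∀ v w w', w < w' → (v, w) ∈ E.filter (fun p => rk p % 2 = b) →
      (v, w') ∈ E.filter (fun p => rk p % 2 = b) → ∃ x, w < x ∧ x < w' ∧ (v, x) ∈ E := by
    intro b v w w' hww h1 h2
    rw [Finset.mem_filter] at h1 h2
    by_contra! hcon
    have h3 : rk (v, w') = rk (v, w) + 1 := by
      have : (E.filter fun q => q.1 = v ∧ q.2 < w') =
          insert (v, w) (E.filter fun q => q.1 = v ∧ q.2 < w) := by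
        ext ⟨a, d⟩
        simp only [Finset.mem_filter, Finset.mem_insert, Prod.mk.injEq]
        constructor
        · rintro ⟨h, rfl, hd⟩
          rcases lt_trichotomy d w with hlt | heq | hgt
          · exact Or.inr ⟨h, rfl, hlt⟩
          · exact Or.inl ⟨rfl, heq⟩
          · exact absurd h (hcon d hgt hd)
        · rintro (⟨rfl, rfl⟩ | ⟨h, rfl, hd⟩)
          · exact ⟨h1.1, rfl, hww⟩
          · exact ⟨h, rfl, hd.trans hww⟩
      simp only [hrk, this]
      rw [Finset.card_insert_of_notMem (by simp)]
    omega
  have hsum := Finset.card_filter_add_card_filter_not (s := E) (fun p => rk p % 2 = 0)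
  have hne : (E.filter fun p => ¬ rk p % 2 = 0) = E.filter fun p => rk p % 2 = 1 := by
    refine Finset.filter_congr fun p _ => ?_
    omega
  rw [hne] at hsum
  rcases le_total (E.filter fun p => rk p % 2 = 0).card (E.filter fun p => rk p % 2 = 1).card
    with hle | hle
  · exact ⟨_, Finset.filter_subset _ _, by omega, key 1⟩
  · exact ⟨_, Finset.filter_subset _ _, by omega, key 0⟩

/-- Discarding the last edge at each left endpoint costs at most `n` edges. -/
theorem exists_not_last (n : ℕ) (E : Finset (ℕ × ℕ)) (hE : IsHost n E) :
    ∃ E' ⊆ E, E.card ≤ 2 * E'.card + n ∧ ∀ v w, (v, w) ∈ E' → ∃ x, w < x ∧ (v, x) ∈ E := by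
  classical
  refine ⟨E.filter fun p => ∃ x, p.2 < x ∧ (p.1, x) ∈ E, Finset.filter_subset _ _, ?_, ?_⟩
  · have hsum := Finset.card_filter_add_card_filter_not (s := E)
      (fun p => ∃ x, p.2 < x ∧ (p.1, x) ∈ E)
    have : (E.filter fun p => ¬ ∃ x, p.2 < x ∧ (p.1, x) ∈ E).card ≤ (Finset.range n).card := by
      refine Finset.card_le_card_of_injOn Prod.fst (fun p hp => ?_) fun p hp q hq hpq => ?_
      · have := hE p (Finset.mem_filter.1 hp).1
        simpa using this.1.trans this.2
      · obtain ⟨hp1, hp2⟩ := Finset.mem_filter.1 hp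
        obtain ⟨hq1, hq2⟩ := Finset.mem_filter.1 hq
        push Not at hp2 hq2
        obtain ⟨a, b⟩ := p
        obtain ⟨a', b'⟩ := q
        simp only at hpq
        subst hpq
        rcases lt_trichotomy b b' with h | h | h
        · exact absurd hq1 (hp2 _ h)
        · rw [h]
        · exact absurd hp1 (hq2 _ h)
    rw [Finset.card_range] at this
    omega
  · intro v w h
    exact (Finset.mem_filter.1 h).2

theorem exists_not_first (n : ℕ) (E : Finset (ℕ × ℕ)) (hE : IsHost n E) :
    ∃ E' ⊆ E, E.card ≤ 2 * E'.card + n ∧ ∀ v w, (v, w) ∈ E' → ∃ x, x < w ∧ (v, x) ∈ E := by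
  classical
  refine ⟨E.filter fun p => ∃ x, x < p.2 ∧ (p.1, x) ∈ E, Finset.filter_subset _ _, ?_, ?_⟩
  · have hsum := Finset.card_filter_add_card_filter_not (s := E)
      (fun p => ∃ x, x < p.2 ∧ (p.1, x) ∈ E)
    have : (E.filter fun p => ¬ ∃ x, x < p.2 ∧ (p.1, x) ∈ E).card ≤ (Finset.range n).card := by
      refine Finset.card_le_card_of_injOn Prod.fst (fun p hp => ?_) fun p hp q hq hpq => ?_
      · have := hE p (Finset.mem_filter.1 hp).1
        simpa using this.1.trans this.2
      · obtain ⟨hp1, hp2⟩ := Finset.mem_filter.1 hp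
        obtain ⟨hq1, hq2⟩ := Finset.mem_filter.1 hq
        push Not at hp2 hq2
        obtain ⟨a, b⟩ := p
        obtain ⟨a', b'⟩ := q
        simp only at hpq
        subst hpq
        rcases lt_trichotomy b b' with h | h | h
        · exact absurd hp1 (hq2 _ h)
        · rw [h]
        · exact absurd hq1 (hp2 _ h)
    rw [Finset.card_range] at this
    omega
  · intro v w h
    exact (Finset.mem_filter.1 h).2

theorem exists_of_forall_pair {m : ℕ} {g : SimpleGraph (Fin (m + 1))} {r c : ℕ}
    (hc : c < m + 1)
    (h : (∀ u : Fin (m + 1), g.Adj u ⟨c, hc⟩ → (u : ℕ) = r) → False) :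
    ∃ r' ≠ r, (r', c) ∈ (OrderedGraph.mk (m + 1) g).edgePairs ∨
      (c, r') ∈ (OrderedGraph.mk (m + 1) g).edgePairs := by
  by_contra! hcon
  refine h fun u hu => ?_
  by_contra hne
  obtain ⟨h1, h2⟩ := hcon u hne
  rcases lt_or_gt_of_ne hu.ne with hlt | hlt
  · exact h1 (mem_edgePairs (G := ⟨m + 1, g⟩) (u := u) (v := ⟨c, hc⟩) |>.2 ⟨hlt, hu⟩)
  · exact h2 (mem_edgePairs (G := ⟨m + 1, g⟩) (u := ⟨c, hc⟩) (v := u) |>.2 ⟨hlt, hu.symm⟩)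

theorem adj_of_mem_edgePairs {n : ℕ} {g : SimpleGraph (Fin n)} {a b : ℕ} (ha : a < n) (hb : b < n)
    (h : (a, b) ∈ (OrderedGraph.mk n g).edgePairs) : g.Adj ⟨a, ha⟩ ⟨b, hb⟩ :=
  (mem_edgePairs (G := ⟨n, g⟩) (u := ⟨a, ha⟩) (v := ⟨b, hb⟩) |>.1 h).2

/-- If `r` is adjacent to three later consecutive vertices, then the middle one has another
neighbour. -/
theorem IsMinimallyNonlinear.exists_of_three {G : OrderedGraph} (h : G.IsMinimallyNonlinear)
    {r c : ℕ} (h1 : (r, c) ∈ G.edgePairs) (h2 : (r, c + 1) ∈ G.edgePairs)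
    (h3 : (r, c + 2) ∈ G.edgePairs) :
    ∃ r' ≠ r, (r', c + 1) ∈ G.edgePairs ∨ (c + 1, r') ∈ G.edgePairs := by
  obtain ⟨hrc, -⟩ := G.isHost_edgePairs _ h1
  obtain ⟨-, ho⟩ := G.isHost_edgePairs _ h3
  obtain ⟨o, g⟩ := G
  simp only at hrc ho
  obtain ⟨m, rfl⟩ : ∃ m, o = m + 1 := ⟨o - 1, by omega⟩
  refine exists_of_forall_pair (by omega) fun honly => ?_
  have e1 : (Fin.succAbove (⟨c + 1, by omega⟩ : Fin (m + 1)) ⟨r, by omega⟩) = ⟨r, by omega⟩ := by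
    ext; rw [val_succAbove]; simp only; split_ifs <;> omega
  have e2 : (Fin.succAbove (⟨c + 1, by omega⟩ : Fin (m + 1)) ⟨c, by omega⟩) = ⟨c, by omega⟩ := by
    ext; rw [val_succAbove]; simp only; split_ifs <;> omega
  have e3 : (Fin.succAbove (⟨c + 1, by omega⟩ : Fin (m + 1)) ⟨c + 1, by omega⟩) =
      ⟨c + 2, by omega⟩ := by
    ext; rw [val_succAbove]; simp only; split_ifs <;> omega
  refine h.false_of_pendant ⟨c + 1, by omega⟩ ⟨r, by omega⟩ (by simp only; omega)
    (fun u hu => by rw [e1]; ext; exact honly u hu) fun n E hE => ?_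
  obtain ⟨E', hE', hcard, hkey⟩ := exists_alternate n E
  refine ⟨E', hE', hcard, fun f hf hfE => ?_⟩
  -- After deletion of `c + 1`, the vertices `c` and `c + 2` are consecutive, so `x` between their
  -- images takes the place of the missing vertex.
  obtain ⟨x, hx1, hx2, hx⟩ := hkey (f ⟨r, by omega⟩) (f ⟨c, by omega⟩) (f ⟨c + 1, by omega⟩)
    (hf (by simp)) (hfE _ _ (by simpa using hrc) (by
      rw [e1, e2]; exact adj_of_mem_edgePairs _ _ h1))
    (hfE _ _ (by simp only [Fin.mk_lt_mk]; omega) (by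
      rw [e1, e3]; exact adj_of_mem_edgePairs _ _ h3))
  refine ⟨x, hx, fun i hi => lt_of_le_of_lt (hf.monotone ?_) hx1,
    fun i hi => lt_of_lt_of_le hx2 (hf.monotone ?_)⟩
  · simp only [Fin.le_def] at hi ⊢; omega
  · simpa [Fin.le_def] using hi

/-- The last vertex has another neighbour if it shares a neighbour with the preceding vertex. -/
theorem IsMinimallyNonlinear.exists_of_last {G : OrderedGraph} (h : G.IsMinimallyNonlinear)
    {r c : ℕ} (h1 : (r, c) ∈ G.edgePairs) (h2 : (r, c + 1) ∈ G.edgePairs)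
    (h3 : G.order = c + 2) :
    ∃ r' ≠ r, (r', c + 1) ∈ G.edgePairs ∨ (c + 1, r') ∈ G.edgePairs := by
  obtain ⟨hrc, -⟩ := G.isHost_edgePairs _ h1
  obtain ⟨o, g⟩ := G
  simp only at hrc h3
  subst h3
  refine exists_of_forall_pair (by omega) fun honly => ?_
  have e1 : (Fin.succAbove (⟨c + 1, by omega⟩ : Fin (c + 1 + 1)) ⟨r, by omega⟩) = ⟨r, by omega⟩ := by
    ext; rw [val_succAbove]; simp only; split_ifs <;> omega
  have e2 : (Fin.succAbove (⟨c + 1, by omega⟩ : Fin (c + 1 + 1)) ⟨c, by omega⟩) = ⟨c, by omega⟩ := by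
    ext; rw [val_succAbove]; simp only; split_ifs <;> omega
  refine h.false_of_pendant ⟨c + 1, by omega⟩ ⟨r, by omega⟩ (by simp only; omega)
    (fun u hu => by rw [e1]; ext; exact honly u hu) fun n E hE => ?_
  obtain ⟨E', hE', hcard, hkey⟩ := exists_not_last n E hE
  refine ⟨E', hE', hcard, fun f hf hfE => ?_⟩
  obtain ⟨x, hx1, hx⟩ := hkey (f ⟨r, by omega⟩) (f ⟨c, by omega⟩)
    (hfE _ _ (by simpa using hrc) (by
      rw [e1, e2]; exact adj_of_mem_edgePairs _ _ h1))
  refine ⟨x, hx, fun i hi => lt_of_le_of_lt (hf.monotone ?_) hx1, fun i hi => ?_⟩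
  · simp only [Fin.le_def] at hi ⊢; omega
  · have := i.2
    simp only at hi
    omega

/-- If `r` is adjacent to the next two vertices, then the first of them has another neighbour. -/
theorem IsMinimallyNonlinear.exists_of_first {G : OrderedGraph} (h : G.IsMinimallyNonlinear)
    {r : ℕ} (h1 : (r, r + 1) ∈ G.edgePairs) (h2 : (r, r + 2) ∈ G.edgePairs) :
    ∃ r' ≠ r, (r', r + 1) ∈ G.edgePairs ∨ (r + 1, r') ∈ G.edgePairs := by
  obtain ⟨-, ho⟩ := G.isHost_edgePairs _ h2
  obtain ⟨o, g⟩ := G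
  simp only at ho
  obtain ⟨m, rfl⟩ : ∃ m, o = m + 1 := ⟨o - 1, by omega⟩
  refine exists_of_forall_pair (by omega) fun honly => ?_
  have e1 : (Fin.succAbove (⟨r + 1, by omega⟩ : Fin (m + 1)) ⟨r, by omega⟩) = ⟨r, by omega⟩ := by
    ext; rw [val_succAbove]; simp only; split_ifs <;> omega
  have e3 : (Fin.succAbove (⟨r + 1, by omega⟩ : Fin (m + 1)) ⟨r + 1, by omega⟩) =
      ⟨r + 2, by omega⟩ := by
    ext; rw [val_succAbove]; simp only; split_ifs <;> omega
  refine h.false_of_pendant ⟨r + 1, by omega⟩ ⟨r, by omega⟩ (by simp)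
    (fun u hu => by rw [e1]; ext; exact honly u hu) fun n E hE => ?_
  obtain ⟨E', hE', hcard, hkey⟩ := exists_not_first n E hE
  refine ⟨E', hE', hcard, fun f hf hfE => ?_⟩
  obtain ⟨x, hx2, hx⟩ := hkey (f ⟨r, by omega⟩) (f ⟨r + 1, by omega⟩)
    (hfE _ _ (by simp) (by rw [e1, e3]; exact adj_of_mem_edgePairs _ _ h2))
  refine ⟨x, hx, fun i hi => lt_of_le_of_lt (hf.monotone ?_) (hE _ hx).1,
    fun i hi => lt_of_lt_of_le hx2 (hf.monotone ?_)⟩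
  · simp only [Fin.le_def] at hi ⊢; omega
  · simpa [Fin.le_def] using hi

/-! ### Trivially linear graphs and isolated vertices -/

/-- An ordered graph with at most two vertices has linear extremal function. -/
theorem hasLinearBound_of_order_le_two {G : OrderedGraph} (h : G.order ≤ 2) : G.HasLinearBound := by
  refine ⟨4, fun n E hE hG => ?_⟩
  by_contra hcard
  have hne : E.Nonempty := by
    rw [Finset.nonempty_iff_ne_empty]
    rintro rfl
    simp at hcard
  obtain ⟨⟨a, b⟩, hp⟩ := hne
  obtain ⟨h1, h2⟩ := hE _ hp
  simp only at h1 h2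
  refine hG ⟨fun u => if (u : ℕ) = 0 then a else b, fun u v huv => ?_, fun u => ?_,
    fun u v huv _ => ?_⟩
  · have := u.2; have := v.2
    rw [Fin.lt_def] at huv
    dsimp only
    rw [if_pos (by omega), if_neg (by omega)]
    exact h1
  · dsimp only; split_ifs <;> omega
  · have := u.2; have := v.2
    rw [Fin.lt_def] at huv
    dsimp only
    rw [if_pos (by omega), if_neg (by omega)]
    exact hp

/-- An ordered graph without edges has linear extremal function. -/
theorem hasLinearBound_of_edgeless {G : OrderedGraph} (h : ∀ u v, ¬ G.graph.Adj u v) :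
    G.HasLinearBound := by
  refine ⟨G.order, fun n E hE hG => ?_⟩
  have hn : n < G.order := by
    by_contra hn
    exact hG ⟨fun u => u, fun u v huv => huv, fun u => u.2.trans_le (not_lt.1 hn),
      fun u v _ hadj => absurd hadj (h u v)⟩
  exact hE.card_le.trans (Nat.mul_le_mul hn.le n.le_succ)

/-- The pairs of cells of length two whose members with offsets `i` and `j` form an edge. -/
def halfHost (n : ℕ) (E : Finset (ℕ × ℕ)) (i j : ℕ) : Finset (ℕ × ℕ) :=
  (Finset.range ((n - 3) / 2) ×ˢ Finset.range ((n - 3) / 2)).filter fun p =>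
    p.1 < p.2 ∧ (2 * p.1 + i, 2 * p.2 + 2 + j) ∈ E

theorem mem_halfHost {n : ℕ} {E : Finset (ℕ × ℕ)} {i j : ℕ} {p : ℕ × ℕ} :
    p ∈ halfHost n E i j ↔ (p.1 < (n - 3) / 2 ∧ p.2 < (n - 3) / 2) ∧ p.1 < p.2 ∧
      (2 * p.1 + i, 2 * p.2 + 2 + j) ∈ E := by
  simp [halfHost]

/-- An edge `(v, w)` with `v + 4 ≤ w` and `w + 2 < n` appears in the half host given by the parities
of `v` and `w`. The exceptions have one of four short lengths or one of two last right endpoints, at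
most `6 * n` in all. -/
theorem card_le_of_halfHost {n : ℕ} {E : Finset (ℕ × ℕ)} (hE : IsHost n E) {B : ℕ}
    (hB : ∀ i < 2, ∀ j < 2, (halfHost n E i j).card ≤ B) : E.card ≤ 4 * B + 6 * n := by
  have hsub : E ⊆ ((Finset.range 2 ×ˢ Finset.range 2).biUnion fun q =>
      (halfHost n E q.1 q.2).image fun p => (2 * p.1 + q.1, 2 * p.2 + 2 + q.2)) ∪
      ((Finset.range n ×ˢ Finset.range 4).image (fun p => (p.1, p.1 + p.2)) ∪
      (Finset.range n ×ˢ Finset.range 2).image fun p => (p.1, n - 1 - p.2)) := by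
    rintro ⟨v, w⟩ hp
    obtain ⟨h1, h2⟩ := hE _ hp
    simp only at h1 h2
    simp only [Finset.mem_union, Finset.mem_biUnion, Finset.mem_image, Finset.mem_product,
      Finset.mem_range, Prod.mk.injEq, Prod.exists, mem_halfHost]
    by_cases hA : w < v + 4
    · exact Or.inr (Or.inl ⟨v, w - v, ⟨by omega, by omega⟩, rfl, by omega⟩)
    by_cases hC : n ≤ w + 2
    · exact Or.inr (Or.inr ⟨v, n - 1 - w, ⟨by omega, by omega⟩, rfl, by omega⟩)
    refine Or.inl ⟨v % 2, w % 2, ⟨by omega, by omega⟩, v / 2, w / 2 - 1,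
      ⟨⟨by omega, by omega⟩, by omega, ?_⟩, by omega, by omega⟩
    rwa [show 2 * (v / 2) + v % 2 = v by omega, show 2 * (w / 2 - 1) + 2 + w % 2 = w by omega]
  refine (Finset.card_le_card hsub).trans ((Finset.card_union_le _ _).trans ?_)
  have h1 := Finset.card_biUnion_le_card_mul (Finset.range 2 ×ˢ Finset.range 2)
    (fun q : ℕ × ℕ => (halfHost n E q.1 q.2).image fun p => (2 * p.1 + q.1, 2 * p.2 + 2 + q.2)) B
    (fun q hq => by
      simp only [Finset.mem_product, Finset.mem_range] at hq
      exact Finset.card_image_le.trans (hB _ hq.1 _ hq.2))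
  have h2 := Finset.card_union_le
    ((Finset.range n ×ˢ Finset.range 4).image (fun p : ℕ × ℕ => (p.1, p.1 + p.2)))
    ((Finset.range n ×ˢ Finset.range 2).image fun p : ℕ × ℕ => (p.1, n - 1 - p.2))
  have h3 := Finset.card_image_le (s := Finset.range n ×ˢ Finset.range 4)
    (f := fun p : ℕ × ℕ => (p.1, p.1 + p.2))
  have h4 := Finset.card_image_le (s := Finset.range n ×ˢ Finset.range 2)
    (f := fun p : ℕ × ℕ => (p.1, n - 1 - p.2))
  simp only [Finset.card_product, Finset.card_range] at h1 h3 h4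
  omega

/-- In a minimally non-linear bipartite ordered graph, no vertex of the second part is isolated. -/
theorem IsMinimallyNonlinear.exists_neighbor {G : OrderedGraph} (h : G.IsMinimallyNonlinear)
    {k l : ℕ} (hs : G.IsBipartiteSplit k l) {c : ℕ} (hkc : k ≤ c) (hcl : c < k + l) :
    ∃ r, (r, c) ∈ G.edgePairs := by
  by_contra! hiso
  -- Positivity of `k` ensures that the isolated vertex has a predecessor, beside which it will be
  -- inserted.
  have hk : 0 < k := by
    by_contra hk
    refine (hasLinearBound_of_edgeless fun u v hadj => ?_).not_isNonlinear h.1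
    rcases lt_or_gt_of_ne hadj.ne with hlt | hlt
    · have := hs.2 u v hlt hadj
      omega
    · have := hs.2 v u hlt hadj.symm
      omega
  obtain ⟨o, g⟩ := G
  obtain ⟨ho, hs⟩ := hs
  simp only at ho hs
  obtain ⟨m, rfl⟩ : ∃ m, o = m + 1 := ⟨o - 1, by omega⟩
  set c' : Fin (m + 1) := ⟨c, by omega⟩ with hc'
  have hno : ∀ u, ¬ g.Adj u c' := by
    intro u hu
    rcases lt_or_gt_of_ne hu.ne with hlt | hlt
    · exact hiso u (mem_edgePairs (G := ⟨m + 1, g⟩) (u := u) (v := c') |>.2 ⟨hlt, hu⟩)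
    · have := hs c' u hlt hu.symm
      simp only [hc'] at this
      omega
  obtain ⟨C, hC⟩ := h.hasLinearBound_deleteVertex c'
  refine HasLinearBound.not_isNonlinear ⟨4 * C + 6, fun n E hE hG => ?_⟩ h.1
  have hcard : E.card ≤ 4 * (C * (n + 1)) + 6 * n := by
    refine card_le_of_halfHost hE fun i hi j hj => ?_
    have := hC ((n - 3) / 2) (halfHost n E i j) (fun p hp => ?_) ?_
    · refine this.trans (Nat.mul_le_mul_left _ ?_)
      omega
    · rw [mem_halfHost] at hp
      exact ⟨hp.2.1, hp.1.2⟩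
    rintro ⟨(f : Fin m → ℕ), hf, hfn, hfE⟩
    replace hfn : ∀ u : Fin m, f u < (n - 3) / 2 := hfn
    replace hfE : ∀ u v : Fin m, u < v → g.Adj (c'.succAbove u) (c'.succAbove v) →
      (f u, f v) ∈ halfHost n E i j := hfE
    -- Doubling separates images on the same side by two. The extra shift by 2 on the right keeps
    -- this gap across the boundary of the parts, whatever the offsets `i` and `j`.
    set φ : Fin m → ℕ := fun u => if (u : ℕ) < k then 2 * f u + i else 2 * f u + 2 + j with hφ
    have hgap : ∀ u v : Fin m, u < v → φ u + 2 ≤ φ v := by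
      intro u v huv
      have h1 : f u < f v := hf huv
      rw [Fin.lt_def] at huv
      simp only [hφ]
      split_ifs <;> omega
    have hφm : StrictMono φ := fun u v huv => by have := hgap u v huv; omega
    have hφn : ∀ u, φ u + 1 < n := by
      intro u
      have := hfn u
      simp only [hφ]
      split_ifs <;> omega
    have hmono := strictMono_insertNth' c' hφm (x := φ ⟨c - 1, by omega⟩ + 1)
      (fun i hi => Nat.lt_succ_of_le (hφm.monotone (by
        simp only [hc', Fin.le_def] at hi ⊢; omega)))
      (fun i hi => by
        have := hgap ⟨c - 1, by omega⟩ i (by simp only [hc', Fin.lt_def] at hi ⊢; omega)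
        omega)
    refine hG ⟨_, hmono, fun (u : Fin (m + 1)) => ?_, fun (u v : Fin (m + 1)) huv hadj => ?_⟩
    · rcases Fin.eq_self_or_eq_succAbove c' u with h0 | ⟨i, rfl⟩
      · rw [h0, Fin.insertNth_apply_same]
        exact hφn _
      · rw [Fin.insertNth_apply_succAbove]
        exact Nat.lt_of_succ_lt (hφn i)
    · rcases Fin.eq_self_or_eq_succAbove c' u with h0 | ⟨u, rfl⟩
      · exact absurd (h0 ▸ hadj.symm) (hno v)
      · rcases Fin.eq_self_or_eq_succAbove c' v with h0 | ⟨v, rfl⟩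
        · exact absurd (h0 ▸ hadj) (hno _)
        · rw [Fin.insertNth_apply_succAbove, Fin.insertNth_apply_succAbove]
          have h1 := hfE u v (Fin.succAbove_lt_succAbove_iff.1 huv) hadj
          have h2 := hs _ _ huv hadj
          rw [val_succAbove, val_succAbove] at h2
          simp only [hc'] at h2
          have hu : (u : ℕ) < k := by split_ifs at h2 <;> omega
          have hv : ¬ (v : ℕ) < k := by split_ifs at h2 <;> omega
          simp only [hφ, if_pos hu, if_neg hv]
          exact (mem_halfHost.1 h1).2.2
  calc E.card ≤ 4 * (C * (n + 1)) + 6 * n := hcard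
    _ ≤ (4 * C + 6) * (n + 1) := by ring_nf; omega

/-! ### Two ordered graphs that are not linear -/

/-- Vertices `r < s < c < d` with edges `rc`, `rd`, `sd`. -/
def zigzag : OrderedGraph := ofPairs 4 {(0, 2), (0, 3), (1, 3)}

/-- Vertices `r < s < c₁ < c₂ < c₃` with edges `rc₁`, `rc₃`, `sc₂`. -/
def interleaved : OrderedGraph := ofPairs 5 {(0, 2), (0, 4), (1, 3)}

theorem isHost_zigzag : IsHost 4 {(0, 2), (0, 3), (1, 3)} := by
  intro p hp
  fin_cases hp <;> simp

theorem isHost_interleaved : IsHost 5 {(0, 2), (0, 4), (1, 3)} := by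
  intro p hp
  fin_cases hp <;> simp

theorem exists_zigzag_of_map {f : Fin zigzag.order → ℕ} {E : Finset (ℕ × ℕ)} (hf : StrictMono f)
    (h : ∀ u v, u < v → zigzag.graph.Adj u v → (f u, f v) ∈ E) :
    ∃ r s c d, r < s ∧ s < c ∧ c < d ∧ (r, c) ∈ E ∧ (r, d) ∈ E ∧ (s, d) ∈ E := by
  have key : ∀ u v : Fin 4, ((u : ℕ), (v : ℕ)) ∈ ({(0, 2), (0, 3), (1, 3)} : Finset (ℕ × ℕ)) →
      (f u, f v) ∈ E := by
    intro u v huv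
    have := isHost_zigzag _ huv
    exact h u v this.1 ⟨fun he => this.1.ne (congrArg Fin.val he), Or.inl huv⟩
  exact ⟨f (0 : Fin 4), f (1 : Fin 4), f (2 : Fin 4), f (3 : Fin 4),
    hf (show (0 : Fin 4) < 1 by decide), hf (show (1 : Fin 4) < 2 by decide),
    hf (show (2 : Fin 4) < 3 by decide), key 0 2 (by simp), key 0 3 (by simp), key 1 3 (by simp)⟩

theorem exists_interleaved_of_map {f : Fin interleaved.order → ℕ} {E : Finset (ℕ × ℕ)}
    (hf : StrictMono f) (h : ∀ u v, u < v → interleaved.graph.Adj u v → (f u, f v) ∈ E) :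
    ∃ r s a b c, r < s ∧ s < a ∧ a < b ∧ b < c ∧ (r, a) ∈ E ∧ (r, c) ∈ E ∧ (s, b) ∈ E := by
  have key : ∀ u v : Fin 5, ((u : ℕ), (v : ℕ)) ∈ ({(0, 2), (0, 4), (1, 3)} : Finset (ℕ × ℕ)) →
      (f u, f v) ∈ E := by
    intro u v huv
    have := isHost_interleaved _ huv
    exact h u v this.1 ⟨fun he => this.1.ne (congrArg Fin.val he), Or.inl huv⟩
  exact ⟨f (0 : Fin 5), f (1 : Fin 5), f (2 : Fin 5), f (3 : Fin 5), f (4 : Fin 5),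
    hf (show (0 : Fin 5) < 1 by decide), hf (show (1 : Fin 5) < 2 by decide),
    hf (show (2 : Fin 5) < 3 by decide), hf (show (3 : Fin 5) < 4 by decide),
    key 0 2 (by simp), key 0 4 (by simp), key 1 3 (by simp)⟩

theorem contains_ofPairs {G : OrderedGraph} {n : ℕ} {E : Finset (ℕ × ℕ)} (f : Fin n → ℕ)
    (hf : StrictMono f) (hn : ∀ u, f u < G.order)
    (h : ∀ u v : Fin n, u < v → ((u : ℕ), (v : ℕ)) ∈ E ∨ ((v : ℕ), (u : ℕ)) ∈ E →
      (f u, f v) ∈ G.edgePairs) : G.Contains (ofPairs n E) :=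
  contains_iff_embedsIn.2 ⟨f, hf, hn, fun u v huv hadj => h u v huv hadj.2⟩

theorem contains_zigzag {G : OrderedGraph} {r s c d : ℕ} (hrs : r < s) (hsc : s < c) (hcd : c < d)
    (h1 : (r, c) ∈ G.edgePairs) (h2 : (r, d) ∈ G.edgePairs) (h3 : (s, d) ∈ G.edgePairs) :
    G.Contains zigzag := by
  have hd := (G.isHost_edgePairs _ h2).2
  simp only at hd
  refine contains_ofPairs ![r, s, c, d] ?_ ?_ ?_
  · intro u v huv
    fin_cases u <;> fin_cases v <;> simp_all <;> omega
  · intro u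
    fin_cases u <;> simp <;> omega
  · intro u v huv
    fin_cases u <;> fin_cases v <;> simp_all

theorem contains_interleaved {G : OrderedGraph} {r s a b c : ℕ} (hrs : r < s) (hsa : s < a)
    (hab : a < b) (hbc : b < c) (h1 : (r, a) ∈ G.edgePairs) (h2 : (r, c) ∈ G.edgePairs)
    (h3 : (s, b) ∈ G.edgePairs) : G.Contains interleaved := by
  have hd := (G.isHost_edgePairs _ h2).2
  simp only at hd
  refine contains_ofPairs ![r, s, a, b, c] ?_ ?_ ?_
  · intro u v huv
    fin_cases u <;> fin_cases v <;> simp_all <;> omega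
  · intro u
    fin_cases u <;> simp <;> omega
  · intro u v huv
    fin_cases u <;> fin_cases v <;> simp_all

/-- Join `i` to `i + 2 ^ a`. If `rc`, `rd`, `sd` have lengths `2 ^ a`, `2 ^ b`, `2 ^ e`, then `a`
and `e` are less than `b`, so `c ≤ r + 2 ^ (b - 1) ≤ s`, contrary to `s < c`. The host has `2 ^ t *
(t + 1)` edges on `2 * 2 ^ t` vertices, and `t = 3 * C` is large enough. -/
theorem not_hasLinearBound_zigzag : ¬ zigzag.HasLinearBound := by
  rintro ⟨C, hC⟩
  set t := 3 * C with ht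
  set E : Finset (ℕ × ℕ) :=
    (Finset.range (2 ^ t) ×ˢ Finset.range (t + 1)).image fun p => (p.1, p.1 + 2 ^ p.2) with hE
  have hmem : ∀ {i j}, (i, j) ∈ E → ∃ a ≤ t, j = i + 2 ^ a ∧ i < 2 ^ t := by
    intro i j h
    simp only [hE, Finset.mem_image, Finset.mem_product, Finset.mem_range, Prod.exists,
      Prod.mk.injEq] at h
    obtain ⟨i, a, ⟨h1, h2⟩, rfl, rfl⟩ := h
    exact ⟨a, by omega, rfl, h1⟩
  have hcard : E.card = 2 ^ t * (t + 1) := by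
    rw [hE, Finset.card_image_of_injective]
    · simp
    · rintro ⟨i, a⟩ ⟨j, b⟩ h
      simp only [Prod.mk.injEq] at h
      obtain ⟨rfl, h⟩ := h
      rw [Nat.pow_right_injective le_rfl (Nat.add_left_cancel h)]
  have := hC (2 * 2 ^ t) E ?_ ?_
  · rw [hcard] at this
    have h1 : 1 ≤ 2 ^ t := Nat.one_le_two_pow
    nlinarith
  · rintro ⟨i, j⟩ h
    obtain ⟨a, ha, rfl, hi⟩ := hmem h
    have h1 : 2 ^ a ≤ 2 ^ t := Nat.pow_le_pow_right two_pos ha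
    have h2 : 0 < 2 ^ a := by positivity
    simp only
    omega
  · rintro ⟨f, hf, -, h⟩
    obtain ⟨r, s, c, d, hrs, hsc, hcd, h1, h2, h3⟩ := exists_zigzag_of_map hf h
    obtain ⟨a, -, rfl, -⟩ := hmem h1
    obtain ⟨b, -, rfl, -⟩ := hmem h2
    obtain ⟨e, -, he, -⟩ := hmem h3
    have hab : 2 ^ (a + 1) ≤ 2 ^ b :=
      Nat.pow_le_pow_right two_pos ((Nat.pow_lt_pow_iff_right one_lt_two).1 (by omega))
    have heb : 2 ^ (e + 1) ≤ 2 ^ b :=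
      Nat.pow_le_pow_right two_pos ((Nat.pow_lt_pow_iff_right one_lt_two).1 (by omega))
    rw [pow_succ] at hab heb
    omega

/-- Encodes lexicographically ordered pairs as `p * K + x`. The slack `x + 1 < K` leaves the
coordinate `K - 1` free beyond all of `S`. -/
theorem exists_lex_code (S : Finset ℕ) : ∃ (K : ℕ) (e : ℕ → ℕ → ℕ), 2 ≤ K ∧ (∀ x ∈ S, x + 1 < K) ∧
    (∀ p x q y, x < K → y < K → (e p x < e q y ↔ p < q ∨ p = q ∧ x < y)) ∧
    (∀ p x q y, x < K → y < K → (e p x = e q y ↔ p = q ∧ x = y)) := by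
  refine ⟨S.sup id + 2, fun p x => p * (S.sup id + 2) + x, by omega, fun x hx => ?_, ?_, ?_⟩
  · have : id x ≤ S.sup id := Finset.le_sup hx
    simp only [id] at this ⊢
    omega
  · generalize S.sup id + 2 = K
    intro p x q y hx hy
    rcases lt_trichotomy p q with h | rfl | h
    · have : (p + 1) * K ≤ q * K := Nat.mul_le_mul_right K h
      rw [add_mul] at this
      simp only [h, true_or, iff_true]
      omega
    · simp
    · have : (q + 1) * K ≤ p * K := Nat.mul_le_mul_right K h
      rw [add_mul] at this
      simp only [h.not_gt, h.ne', false_or, false_and, iff_false]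
      omega
  · generalize S.sup id + 2 = K
    intro p x q y hx hy
    rcases lt_trichotomy p q with h | rfl | h
    · have : (p + 1) * K ≤ q * K := Nat.mul_le_mul_right K h
      rw [add_mul] at this
      simp only [h.ne, false_and, iff_false]
      omega
    · simp
    · have : (q + 1) * K ≤ p * K := Nat.mul_le_mul_right K h
      rw [add_mul] at this
      simp only [h.ne', false_and, iff_false]
      omega

/-- `E` joins letters `(p, j)`, where `p` is a site of `S` and `j ∈ J`, to columns `q ∈ C` beyond the
site. The columns of the letters at one site come in the order of the letters, and no column of
a later letter lies strictly between two columns of an earlier letter beyond the later letter. -/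
structure IsSiteSystem (J S C : Finset ℕ) (E : Finset (ℕ × ℕ × ℕ)) : Prop where
  mem : ∀ p j q, (p, j, q) ∈ E → p ∈ S ∧ j ∈ J ∧ q ∈ C ∧ p < q
  lt : ∀ p j j' q q', j < j' → (p, j, q) ∈ E → (p, j', q') ∈ E → q < q'
  noninterleaved : ∀ p p' j j' a b c, p < p' → p' < a → a < b → b < c →
    (p, j, a) ∈ E → (p, j, c) ∈ E → (p', j', b) ∈ E → False

/-- Induction on `d`, and within it on `J` by adding a new largest letter `a`. Take a system 1 for
`(d + 1, s)` and a system 2 for `d` whose letters are the sites of system 1. Replace each site `p`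
of system 2 by a block, a copy of system 1. The letter `a` at site `(p, x)` receives the `d` columns
that letter `x` had at `p`, and one new column closing block `p`, hence `d + 1` in all. Keeping `F ≤
S.card` makes the cost of one new column per block affordable. -/
theorem exists_isSiteSystem (F d : ℕ) (J : Finset ℕ) : ∃ S C E, IsSiteSystem J S C E ∧
    F ≤ S.card ∧ E.card = d * (J.card * S.card) ∧ F * C.card ≤ d * (J.card * S.card) := by
  induction d generalizing J with
  | zero =>
    exact ⟨Finset.range F, ∅, ∅, ⟨by simp, by simp, by simp⟩, by simp, by simp, by simp⟩
  | succ d ih =>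
  induction J using Finset.induction_on_max with
  | empty => exact ⟨Finset.range F, ∅, ∅, ⟨by simp, by simp, by simp⟩, by simp, by simp, by simp⟩
  | insert a s ha ihs =>
  obtain ⟨S₁, C₁, E₁, h₁, hF₁, hE₁, hC₁⟩ := ihs
  obtain ⟨S₂, C₂, E₂, h₂, hF₂, hE₂, hC₂⟩ := ih S₁
  obtain ⟨K, e, hK, hKS, hlt, heq⟩ := exists_lex_code (S₁ ∪ C₁)
  have hS₁ : ∀ x ∈ S₁, x + 1 < K := fun x hx => hKS x (Finset.mem_union_left _ hx)
  have hC₁K : ∀ x ∈ C₁, x + 1 < K := fun x hx => hKS x (Finset.mem_union_right _ hx)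
  set S := (S₂ ×ˢ S₁).image fun p => e p.1 p.2 with hS
  set C := (S₂ ×ˢ C₁).image (fun p => e p.1 p.2) ∪
    (S₂.image (fun p => e p (K - 1)) ∪ C₂.image fun q => e q 0) with hC
  -- `Ea` consists of the copies of system 1, `Eb` joins `a` to the closing column of each block,
  -- and `Ec` transfers system 2 to the letter `a`.
  set Ea : Finset (ℕ × ℕ × ℕ) :=
    (S₂ ×ˢ E₁).image (fun t => (e t.1 t.2.1, t.2.2.1, e t.1 t.2.2.2)) with hEa
  set Eb : Finset (ℕ × ℕ × ℕ) :=
    (S₂ ×ˢ S₁).image (fun t => (e t.1 t.2, a, e t.1 (K - 1))) with hEb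
  set Ec : Finset (ℕ × ℕ × ℕ) := E₂.image (fun t => (e t.1 t.2.1, a, e t.2.2 0)) with hEc
  have hSmem : ∀ p ∈ S₂, ∀ x ∈ S₁, e p x ∈ S := fun p hp x hx =>
    Finset.mem_image.2 ⟨(p, x), Finset.mem_product.2 ⟨hp, hx⟩, rfl⟩
  have hmem : ∀ {P j Q}, (P, j, Q) ∈ Ea ∪ (Eb ∪ Ec) → ∃ p ∈ S₂, ∃ x ∈ S₁, P = e p x ∧
      ((j ∈ s ∧ ∃ y ∈ C₁, (x, j, y) ∈ E₁ ∧ Q = e p y) ∨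
        (j = a ∧ (Q = e p (K - 1) ∨ ∃ q ∈ C₂, p < q ∧ (p, x, q) ∈ E₂ ∧ Q = e q 0))) := by
    intro P j Q h
    simp only [hEa, hEb, hEc, Finset.mem_union, Finset.mem_image, Finset.mem_product, Prod.exists,
      Prod.mk.injEq] at h
    rcases h with ⟨p, x, i, y, ⟨hp, h⟩, rfl, rfl, rfl⟩ | ⟨p, x, ⟨hp, hx⟩, rfl, rfl, rfl⟩ |
      ⟨p, x, q, h, rfl, rfl, rfl⟩
    · obtain ⟨g1, g2, g3, -⟩ := h₁.mem _ _ _ h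
      exact ⟨p, hp, x, g1, rfl, Or.inl ⟨g2, y, g3, h, rfl⟩⟩
    · exact ⟨p, hp, x, hx, rfl, Or.inr ⟨rfl, Or.inl rfl⟩⟩
    · obtain ⟨g1, g2, g3, g4⟩ := h₂.mem _ _ _ h
      exact ⟨p, g1, x, g2, rfl, Or.inr ⟨rfl, Or.inr ⟨q, g3, g4, h, rfl⟩⟩⟩
  have hScard : S.card = S₂.card * S₁.card := by
    rw [hS, Finset.card_image_of_injOn, Finset.card_product]
    rintro ⟨p, x⟩ hp ⟨q, y⟩ hq h
    simp only [Finset.coe_product, Set.mem_prod, Finset.mem_coe] at hp hq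
    have h1 : x + 1 < K := hS₁ _ hp.2
    have h2 : y + 1 < K := hS₁ _ hq.2
    obtain ⟨rfl, rfl⟩ := (heq _ _ _ _ (by omega) (by omega)).1 h
    rfl
  have hJcard : (insert a s).card = s.card + 1 :=
    Finset.card_insert_of_notMem fun h => lt_irrefl _ (ha a h)
  refine ⟨S, C, Ea ∪ (Eb ∪ Ec), ⟨?_, ?_, ?_⟩, ?_, ?_, ?_⟩
  · intro P j Q hPQ
    obtain ⟨p, hp, x, hx, rfl, ⟨hj, y, hy, h, rfl⟩ | ⟨rfl, rfl | ⟨q, hq, hpq, h, rfl⟩⟩⟩ := hmem hPQ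
    · refine ⟨hSmem p hp x hx, Finset.mem_insert_of_mem hj, Finset.mem_union_left _
        (Finset.mem_image.2 ⟨(p, y), Finset.mem_product.2 ⟨hp, hy⟩, rfl⟩), ?_⟩
      have := (h₁.mem _ _ _ h).2.2.2
      have := hC₁K y hy
      rw [hlt] <;> omega
    · refine ⟨hSmem p hp x hx, Finset.mem_insert_self _ _, Finset.mem_union_right _
        (Finset.mem_union_left _ (Finset.mem_image_of_mem _ hp)), ?_⟩
      have := hS₁ x hx
      rw [hlt] <;> omega
    · refine ⟨hSmem p hp x hx, Finset.mem_insert_self _ _, Finset.mem_union_right _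
        (Finset.mem_union_right _ (Finset.mem_image_of_mem _ hq)), ?_⟩
      have := hS₁ x hx
      rw [hlt] <;> omega
  · intro P j j' Q Q' hjj hPQ hPQ'
    obtain ⟨p, hp, x, hx, rfl, h⟩ := hmem hPQ
    obtain ⟨p', hp', x', hx', he, h'⟩ := hmem hPQ'
    have hxK := hS₁ x hx
    have hxK' := hS₁ x' hx'
    obtain ⟨rfl, rfl⟩ := (heq _ _ _ _ (by omega) (by omega)).1 he
    rcases h with ⟨hj, y, hy, h, rfl⟩ | ⟨rfl, -⟩
    · have hyK := hC₁K y hy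
      rcases h' with ⟨hj', y', hy', h', rfl⟩ | ⟨rfl, rfl | ⟨q, hq, hpq, h', rfl⟩⟩
      · have hyK' := hC₁K y' hy'
        have := h₁.lt _ _ _ _ _ hjj h h'
        rw [hlt] <;> omega
      · rw [hlt] <;> omega
      · rw [hlt] <;> omega
    · rcases h' with ⟨hj', -⟩ | ⟨rfl, -⟩
      · exact absurd (ha _ hj') hjj.not_gt
      · exact absurd hjj (lt_irrefl _)
  · intro P P' j j' A B D hPP hPA hAB hBD hPA' hPD hPB
    obtain ⟨p, hp, x, hx, rfl, hA⟩ := hmem hPA'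
    obtain ⟨p₁, hp₁, x₁, hx₁, he, hD⟩ := hmem hPD
    obtain ⟨r, hr, z, hz, rfl, hB⟩ := hmem hPB
    have hxK := hS₁ x hx
    have hxK₁ := hS₁ x₁ hx₁
    have hzK := hS₁ z hz
    obtain ⟨rfl, rfl⟩ := (heq _ _ _ _ (by omega) (by omega)).1 he
    rw [hlt _ _ _ _ (by omega) (by omega)] at hPP
    rcases hA with ⟨hj, y, hy, hA, rfl⟩ | ⟨rfl, hA⟩
    · rcases hD with ⟨-, w, hw, hD, rfl⟩ | ⟨rfl, -⟩
      · have hyK := hC₁K y hy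
        have hwK := hC₁K w hw
        rw [hlt _ _ _ _ (by omega) (by omega)] at hPA
        -- An old letter has all its columns in its own block, so the later site, lying before one
        -- of them, is in that block too.
        obtain rfl : p = r := by omega
        rcases hB with ⟨-, v, hv, hB, rfl⟩ | ⟨-, rfl | ⟨q, hq, hpq, hB, rfl⟩⟩
        · have hvK := hC₁K v hv
          rw [hlt _ _ _ _ (by omega) (by omega)] at hAB hBD
          exact h₁.noninterleaved x z j j' y v w (by omega) (by omega) (by omega) (by omega) hA hD hB
        · rw [hlt _ _ _ _ (by omega) (by omega)] at hBD
          omega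
        · rw [hlt _ _ _ _ (by omega) (by omega)] at hBD
          omega
      · exact absurd (ha _ hj) (lt_irrefl _)
    · rcases hB with ⟨-, v, hv, hB, rfl⟩ | ⟨-, rfl | ⟨b, hb, hrb, hB, rfl⟩⟩
      · have hvK := hC₁K v hv
        rcases hA with rfl | ⟨q, hq, hpq, hA, rfl⟩
        · rw [hlt _ _ _ _ (by omega) (by omega)] at hAB hPA
          omega
        · rw [hlt _ _ _ _ (by omega) (by omega)] at hAB hPA
          omega
      · rcases hA with rfl | ⟨q, hq, hpq, hA, rfl⟩
        · rw [hlt _ _ _ _ (by omega) (by omega)] at hAB hPA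
          omega
        · rw [hlt _ _ _ _ (by omega) (by omega)] at hAB hPA
          omega
      · rcases hD with ⟨hj, -⟩ | ⟨-, rfl | ⟨c, hc, hpc, hD, rfl⟩⟩
        · exact absurd (ha _ hj) (lt_irrefl _)
        · clear hA
          rw [hlt _ _ _ _ (by omega) (by omega)] at hBD
          omega
        · rw [hlt _ _ _ _ (by omega) (by omega)] at hBD
          rcases hPP with hPP | ⟨rfl, hPP⟩
          · rcases hA with rfl | ⟨q, hq, hpq, hA, rfl⟩
            · rw [hlt _ _ _ _ (by omega) (by omega)] at hPA
              omega
            · rw [hlt _ _ _ _ (by omega) (by omega)] at hPA hAB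
              exact h₂.noninterleaved p r x z q b c (by omega) (by omega) (by omega) (by omega)
                hA hD hB
          -- Both sites lie in one block, so they come from letters `x < z` at one site of system 2.
          -- The ordering of columns by letters excludes `b < c`; this is why `lt` belongs to the
          -- invariant.
          · have := h₂.lt _ _ _ _ _ hPP hD hB
            omega
  · rw [hScard]
    rcases Nat.eq_zero_or_pos F with rfl | hF
    · exact Nat.zero_le _
    · calc F ≤ S₁.card := hF₁
        _ ≤ S₂.card * S₁.card := Nat.le_mul_of_pos_left _ (hF.trans_le hF₂)
  · have hEacard : Ea.card = S₂.card * E₁.card := by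
      rw [hEa, Finset.card_image_of_injOn, Finset.card_product]
      rintro ⟨p, x, i, y⟩ hp ⟨q, z, j, w⟩ hq h
      simp only [Finset.coe_product, Set.mem_prod, Finset.mem_coe] at hp hq
      simp only [Prod.mk.injEq] at h
      obtain ⟨g1, -, g2, -⟩ := h₁.mem _ _ _ hp.2
      obtain ⟨g3, -, g4, -⟩ := h₁.mem _ _ _ hq.2
      have := hS₁ _ g1; have := hS₁ _ g3; have := hC₁K _ g2; have := hC₁K _ g4
      obtain ⟨h1, rfl, h3⟩ := h
      obtain ⟨rfl, rfl⟩ := (heq _ _ _ _ (by omega) (by omega)).1 h1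
      obtain ⟨-, rfl⟩ := (heq _ _ _ _ (by omega) (by omega)).1 h3
      rfl
    have hEbcard : Eb.card = S₂.card * S₁.card := by
      rw [hEb, Finset.card_image_of_injOn, Finset.card_product]
      rintro ⟨p, x⟩ hp ⟨q, y⟩ hq h
      simp only [Finset.coe_product, Set.mem_prod, Finset.mem_coe] at hp hq
      simp only [Prod.mk.injEq] at h
      have := hS₁ _ hp.2; have := hS₁ _ hq.2
      obtain ⟨rfl, rfl⟩ := (heq _ _ _ _ (by omega) (by omega)).1 h.1
      rfl
    have hEccard : Ec.card = E₂.card := by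
      rw [hEc, Finset.card_image_of_injOn]
      rintro ⟨p, x, q⟩ hp ⟨p', x', q'⟩ hq h
      simp only [Prod.mk.injEq] at h
      have := hS₁ _ (h₂.mem _ _ _ hp).2.1; have := hS₁ _ (h₂.mem _ _ _ hq).2.1
      obtain ⟨rfl, rfl⟩ := (heq _ _ _ _ (by omega) (by omega)).1 h.1
      obtain ⟨rfl, -⟩ := (heq _ _ _ _ (by omega) (by omega)).1 h.2.2
      rfl
    have hdisj₂ : Disjoint Eb Ec := by
      rw [Finset.disjoint_left]
      intro t htb htc
      obtain ⟨u, -, rfl⟩ := Finset.mem_image.1 htb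
      obtain ⟨v, -, h⟩ := Finset.mem_image.1 htc
      simp only [Prod.mk.injEq] at h
      have := (heq _ _ _ _ (by omega) (by omega)).1 h.2.2
      omega
    have hdisj₁ : Disjoint Ea (Eb ∪ Ec) := by
      rw [Finset.disjoint_left]
      intro t hta htbc
      obtain ⟨u, hu, rfl⟩ := Finset.mem_image.1 hta
      have h1 := ha _ (h₁.mem _ _ _ (Finset.mem_product.1 hu).2).2.1
      rcases Finset.mem_union.1 htbc with h | h
      · obtain ⟨v, -, h⟩ := Finset.mem_image.1 h
        simp only [Prod.mk.injEq] at h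
        exact absurd h.2.1 h1.ne'
      · obtain ⟨v, -, h⟩ := Finset.mem_image.1 h
        simp only [Prod.mk.injEq] at h
        exact absurd h.2.1 h1.ne'
    rw [Finset.card_union_of_disjoint hdisj₁, Finset.card_union_of_disjoint hdisj₂, hEacard, hEbcard,
      hEccard, hE₁, hE₂, hScard, hJcard]
    ring
  · have hCcard : C.card ≤ S₂.card * C₁.card + (S₂.card + C₂.card) := by
      refine (Finset.card_union_le _ _).trans (add_le_add ?_ ((Finset.card_union_le _ _).trans
        (add_le_add Finset.card_image_le Finset.card_image_le)))
      exact Finset.card_image_le.trans (Finset.card_product _ _).le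
    rw [hScard, hJcard]
    calc F * C.card ≤ F * (S₂.card * C₁.card + (S₂.card + C₂.card)) := Nat.mul_le_mul_left _ hCcard
      _ = S₂.card * (F * C₁.card) + F * S₂.card + F * C₂.card := by ring
      _ ≤ S₂.card * ((d + 1) * (s.card * S₁.card)) + S₁.card * S₂.card +
          d * (S₁.card * S₂.card) := by gcongr
      _ = (d + 1) * ((s.card + 1) * (S₂.card * S₁.card)) := by ring

/-- With one letter and `d = F`, there are `F * S.card` edges on at most `2 * S.card` vertices, and
`F` is arbitrary. -/
theorem not_hasLinearBound_interleaved : ¬ interleaved.HasLinearBound := by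
  intro h
  obtain ⟨D, hD⟩ := h.card_le_of_subset
  set F := 3 * D + 1 with hF
  obtain ⟨S, C, E, hsys, hFS, hE, hC⟩ := exists_isSiteSystem F F {0}
  have hC' : C.card ≤ S.card := by
    rw [Finset.card_singleton, one_mul] at hC
    exact Nat.le_of_mul_le_mul_left hC (by omega)
  rw [Finset.card_singleton, one_mul] at hE
  have hj : ∀ {p j q}, (p, j, q) ∈ E → j = 0 := fun h => by simpa using (hsys.mem _ _ _ h).2.1
  -- Sites become odd and columns even, since sites and columns may coincide as numbers. The
  -- relation `p < q` is preserved as `2 * p + 1 < 2 * q`.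
  have := hD (S.image (fun p => 2 * p + 1) ∪ C.image (fun q => 2 * q))
    (E.image fun t => (2 * t.1 + 1, 2 * t.2.2)) ?_ ?_
  · rw [Finset.card_image_of_injOn, hE] at this
    · have h1 := Finset.card_union_le (S.image (fun p => 2 * p + 1)) (C.image (fun q => 2 * q))
      have h2 := Finset.card_image_le (s := S) (f := fun p => 2 * p + 1)
      have h3 := Finset.card_image_le (s := C) (f := fun q => 2 * q)
      have h4 : F * S.card ≤ D * (3 * S.card) :=
        this.trans (Nat.mul_le_mul_left _ (by omega))
      nlinarith
    · rintro ⟨p, j, q⟩ hp ⟨p', j', q'⟩ hp' he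
      simp only [Prod.mk.injEq] at he
      have h1 := hj hp
      have h2 := hj hp'
      simp only [Prod.mk.injEq]
      omega
  · rintro P hP
    obtain ⟨⟨p, j, q⟩, hp, rfl⟩ := Finset.mem_image.1 hP
    obtain ⟨h1, -, h3, h4⟩ := hsys.mem _ _ _ hp
    refine ⟨by simp only; omega, Finset.mem_union_left _ (Finset.mem_image_of_mem _ h1),
      Finset.mem_union_right _ (Finset.mem_image_of_mem _ h3)⟩
  · rintro ⟨f, hf, hfE⟩
    obtain ⟨r, s, a, b, c, hrs, hsa, hab, hbc, h1, h2, h3⟩ := exists_interleaved_of_map hf hfE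
    simp only [Finset.mem_image, Prod.exists, Prod.mk.injEq] at h1 h2 h3
    obtain ⟨p, j, q, h1, rfl, rfl⟩ := h1
    obtain ⟨p', j', q', h2, he, rfl⟩ := h2
    obtain ⟨p'', j'', q'', h3, rfl, rfl⟩ := h3
    obtain rfl : p' = p := by omega
    obtain rfl := hj h1
    obtain rfl := hj h2
    exact hsys.noninterleaved _ _ _ _ _ _ _ (by omega) (by omega) (by omega) (by omega) h1 h2 h3

end OrderedGraph

/-! ### Counting the entries of an irredundant matrix -/

theorem exists_max_of_fiber (A : Finset (ℕ × ℕ)) (c : ℕ) :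
    ∃ m, (∃ r, (r, c) ∈ A) → (m, c) ∈ A ∧ ∀ r, (r, c) ∈ A → r ≤ m := by
  by_cases h : ∃ r, (r, c) ∈ A
  · have hne : (A.filter fun p => p.2 = c).Nonempty := by
      obtain ⟨r, hr⟩ := h
      exact ⟨(r, c), Finset.mem_filter.2 ⟨hr, rfl⟩⟩
    obtain ⟨⟨m, c'⟩, hmc, hmax⟩ := Finset.exists_max_image _ Prod.fst hne
    obtain ⟨hm, rfl⟩ := Finset.mem_filter.1 hmc
    exact ⟨m, fun _ => ⟨hm, fun r hr => hmax (r, c') (Finset.mem_filter.2 ⟨hr, rfl⟩)⟩⟩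
  · exact ⟨0, fun h' => absurd h' h⟩

theorem exists_min_of_pred (P : ℕ → Prop) : ∃ m, (∃ r, P r) → P m ∧ ∀ r, P r → m ≤ r := by
  classical
  by_cases h : ∃ r, P r
  · exact ⟨Nat.find h, fun _ => ⟨Nat.find_spec h, fun r hr => Nat.find_min' h hr⟩⟩
  · exact ⟨0, fun h' => absurd h' h⟩

/-- A set of entries in rows `0, …, k - 1` and columns `k, …, N - 1` has at most `4k - 4` elements if
no later row lies in the half-open hull of an earlier row and no entry is redundant in the sense
of the last three hypotheses. -/
theorem card_le_of_irredundant {k N : ℕ} {A : Finset (ℕ × ℕ)} (hk : 2 ≤ k)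
    (hA : ∀ p ∈ A, p.1 < k ∧ k ≤ p.2 ∧ p.2 < N)
    (hcol : ∀ c, k ≤ c → c < N → ∃ r, (r, c) ∈ A)
    (hhull : ∀ r s a b c, r < s → (r, a) ∈ A → (r, c) ∈ A → a < b → b ≤ c → (s, b) ∈ A → False)
    (hthree : ∀ r c, (r, c) ∈ A → (r, c + 1) ∈ A → (r, c + 2) ∈ A → ∃ r' ≠ r, (r', c + 1) ∈ A)
    (hlast : ∀ r c, (r, c) ∈ A → (r, c + 1) ∈ A → c + 2 = N → ∃ r' ≠ r, (r', c + 1) ∈ A)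
    (hfirst : (k - 1, k) ∈ A → (k - 1, k + 1) ∈ A → ∃ r' ≠ k - 1, (r', k) ∈ A) :
    A.card + 4 ≤ 4 * k := by
  choose mx hmx using exists_max_of_fiber A
  choose mn hmn using fun c => exists_min_of_pred fun r => (r, c) ∈ A
  choose ft hft using fun r => exists_min_of_pred fun c => (r, c) ∈ A
  have hmxA : ∀ c, k ≤ c → c < N → (mx c, c) ∈ A := fun c h1 h2 => (hmx c (hcol c h1 h2)).1
  have hmxle : ∀ {r c}, (r, c) ∈ A → r ≤ mx c := fun {r c} h => (hmx c ⟨r, h⟩).2 r h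
  have hmnA : ∀ c, k ≤ c → c < N → (mn c, c) ∈ A := fun c h1 h2 => (hmn c (hcol c h1 h2)).1
  have hmnle : ∀ {r c}, (r, c) ∈ A → mn c ≤ r := fun {r c} h => (hmn c ⟨r, h⟩).2 r h
  have hftA : ∀ {r c}, (r, c) ∈ A → (r, ft r) ∈ A := fun {r c} h => (hft r ⟨c, h⟩).1
  have hftle : ∀ {r c}, (r, c) ∈ A → ft r ≤ c := fun {r c} h => (hft r ⟨c, h⟩).2 c h
  -- An entry that is not first in its row is the lowest in its column, so each column has at most
  -- one such entry.
  have hmax : ∀ {r c c'}, (r, c) ∈ A → (r, c') ∈ A → c' < c → mx c = r := by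
    intro r c c' h h' hc
    by_contra hne
    have h1 := hA _ h
    exact hhull r (mx c) c' c c (lt_of_le_of_ne (hmxle h) (Ne.symm hne)) h' h hc le_rfl
      (hmxA c h1.2.1 h1.2.2)
  have hmin : ∀ {r c c'}, (r, c) ∈ A → (r, c') ∈ A → c' < c → mn (c - 1) ≤ r := by
    intro r c c' h h' hc
    by_contra! hlt
    have h1 := hA _ h
    have h2 := hA _ h'
    simp only at h1 h2
    have h3 := hmnA (c - 1) (by omega) (by omega)
    rcases Nat.lt_or_ge c' (c - 1) with h4 | h4
    · exact hhull r _ c' (c - 1) c hlt h' h h4 (by omega) h3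
    · obtain rfl : c' = c - 1 := by omega
      exact absurd (hmnle h') hlt.not_ge
  set cols := Finset.Ico k N with hcols
  -- `NF` indexes the entries that are not first in their row. By `hmin`, the top entry of the
  -- preceding column is in the same row or above it. `R` collects the columns where it is strictly
  -- above, `Ad` those where the row continues from the preceding column. `Ad₁` is the case where
  -- that preceding entry is first in its row.
  set NF := cols.filter fun c => ft (mx c) < c with hNF
  set R := NF.filter fun c => mn (c - 1) < mx c with hR
  set Ad := NF.filter fun c => ¬ mn (c - 1) < mx c with hAd
  set Ad₁ := Ad.filter fun c => ft (mx c) = c - 1 with hAd₁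
  set Ad₂ := Ad.filter fun c => ¬ ft (mx c) = c - 1 with hAd₂
  set Rw := A.image Prod.fst with hRw
  have hRwmem : ∀ {r c}, (r, c) ∈ A → r ∈ Rw := fun {r c} h => Finset.mem_image.2 ⟨_, h, rfl⟩
  have hRwcard : Rw.card ≤ k := by
    calc Rw.card ≤ (Finset.range k).card := Finset.card_le_card fun r hr => by
          obtain ⟨p, hp, rfl⟩ := Finset.mem_image.1 hr
          exact Finset.mem_range.2 (hA p hp).1
      _ = k := Finset.card_range k
  have hNFmem : ∀ {c}, c ∈ NF → k < c ∧ c < N ∧ (mx c, c) ∈ A ∧ ft (mx c) < c := by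
    intro c hc
    obtain ⟨h1, h2⟩ := Finset.mem_filter.1 hc
    obtain ⟨h3, h4⟩ := Finset.mem_Ico.1 h1
    have h5 := hmxA c h3 h4
    have h6 := (hA _ (hftA h5)).2.1
    simp only at h6
    exact ⟨by omega, h4, h5, h2⟩
  have hAdmem : ∀ {c}, c ∈ Ad → k < c ∧ c < N ∧ (mx c, c) ∈ A ∧ ft (mx c) < c ∧
      mn (c - 1) = mx c ∧ (mx c, c - 1) ∈ A := by
    intro c hc
    obtain ⟨h1, h2⟩ := Finset.mem_filter.1 hc
    obtain ⟨h3, h4, h5, h6⟩ := hNFmem h1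
    have h7 := hmin h5 (hftA h5) h6
    have h8 : mn (c - 1) = mx c := le_antisymm h7 (not_lt.1 h2)
    exact ⟨h3, h4, h5, h6, h8, h8 ▸ hmnA (c - 1) (by omega) (by omega)⟩
  have hAcard : A.card ≤ Rw.card + NF.card := by
    rw [← Finset.card_filter_add_card_filter_not (s := A) (fun p => ft p.1 = p.2)]
    refine add_le_add (Finset.card_le_card_of_injOn Prod.fst (fun p hp => ?_) ?_)
      (Finset.card_le_card_of_injOn Prod.snd (fun p hp => ?_) ?_)
    · exact hRwmem (Finset.mem_filter.1 hp).1
    · rintro ⟨r, c⟩ hp ⟨s, d⟩ hq h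
      have h1 := (Finset.mem_filter.1 hp).2
      have h2 := (Finset.mem_filter.1 hq).2
      simp only at h h1 h2
      subst h
      rw [← h1, ← h2]
    · obtain ⟨h1, h2⟩ := Finset.mem_filter.1 hp
      have h3 := hA p h1
      have h4 : ft p.1 < p.2 := lt_of_le_of_ne (hftle h1) h2
      refine Finset.mem_filter.2 ⟨Finset.mem_Ico.2 h3.2, ?_⟩
      rwa [hmax h1 (hftA h1) h4]
    · rintro ⟨r, c⟩ hp ⟨s, d⟩ hq h
      obtain ⟨h1, h2⟩ := Finset.mem_filter.1 hp
      obtain ⟨h3, h4⟩ := Finset.mem_filter.1 hq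
      simp only at h h2 h4
      subst h
      have h5 := hmax h1 (hftA h1) (lt_of_le_of_ne (hftle h1) h2)
      have h6 := hmax h3 (hftA h3) (lt_of_le_of_ne (hftle h3) h4)
      rw [← h5, ← h6]
  have hNFcard : R.card + Ad.card = NF.card := Finset.card_filter_add_card_filter_not _
  have hAdcard : Ad₁.card + Ad₂.card = Ad.card := Finset.card_filter_add_card_filter_not _
  -- If row `mn (c - 1)` met a column `c' - 1 ≥ c`, the lower entry `mx c` of column `c` would lie
  -- in its hull. Hence `c ↦ mn (c - 1)` is injective on `R`, and its values avoid the last row.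
  have hup : ∀ {c c'}, k < c → c < N → k < c' → c' < N → mn (c - 1) < mx c →
      mn (c - 1) = mn (c' - 1) → c' ≤ c := by
    intro c c' h1 h2 h3 h4 h5 h6
    by_contra! hlt
    have h7 := hmnA (c - 1) (by omega) (by omega)
    have h8 := hmnA (c' - 1) (by omega) (by omega)
    rw [← h6] at h8
    exact hhull _ _ (c - 1) c (c' - 1) h5 h7 h8 (by omega) (by omega) (hmxA c h1.le h2)
  have hRmem : ∀ {c}, c ∈ R → k < c ∧ c < N ∧ mn (c - 1) < mx c ∧ mx c < k := by
    intro c hc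
    obtain ⟨h1, h2⟩ := Finset.mem_filter.1 hc
    obtain ⟨h3, h4, h5, -⟩ := hNFmem h1
    exact ⟨h3, h4, h2, (hA _ h5).1⟩
  have hRinj : Set.InjOn (fun c => mn (c - 1)) (R : Set ℕ) := by
    intro c hc c' hc' h
    obtain ⟨h1, h2, h3, -⟩ := hRmem hc
    obtain ⟨h4, h5, h6, -⟩ := hRmem hc'
    exact le_antisymm (hup h4 h5 h1 h2 h6 h.symm) (hup h1 h2 h4 h5 h3 h)
  have hRsub : R.image (fun c => mn (c - 1)) ⊆ Finset.range (k - 1) := by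
    intro x hx
    obtain ⟨c, hc, rfl⟩ := Finset.mem_image.1 hx
    have := hRmem hc
    exact Finset.mem_range.2 (by omega)
  have hRimg : (R.image fun c => mn (c - 1)).card = R.card := Finset.card_image_of_injOn hRinj
  have hRcard : R.card ≤ k - 1 := by
    rw [← hRimg, ← Finset.card_range (k - 1)]
    exact Finset.card_le_card hRsub
  have hAd₁inj : Set.InjOn mx (Ad₁ : Set ℕ) := by
    intro c hc c' hc' h
    obtain ⟨h1, h2⟩ := Finset.mem_filter.1 hc
    obtain ⟨h3, h4⟩ := Finset.mem_filter.1 hc'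
    have := hAdmem h1
    have := hAdmem h3
    rw [h] at h2
    omega
  have hAd₁sub : Ad₁.image mx ⊆ Rw := by
    intro x hx
    obtain ⟨c, hc, rfl⟩ := Finset.mem_image.1 hx
    exact hRwmem (hAdmem (Finset.mem_filter.1 hc).1).2.2.1
  have hAd₁img : (Ad₁.image mx).card = Ad₁.card := Finset.card_image_of_injOn hAd₁inj
  -- If `c - 1` were in `Ad` rather than `R`, the row would have entries in `c - 2`, `c - 1`, `c`
  -- with column `c - 1` otherwise empty, against `hthree`.
  have hAd₂sub : Ad₂.image (fun c => c - 1) ⊆ R := by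
    intro x hx
    obtain ⟨c, hc, rfl⟩ := Finset.mem_image.1 hx
    obtain ⟨h1, h2⟩ := Finset.mem_filter.1 hc
    obtain ⟨h3, h4, h5, h6, h7, h8⟩ := hAdmem h1
    have h9 : ft (mx c) < c - 1 := lt_of_le_of_ne (hftle h8) h2
    have h10 : mx (c - 1) = mx c := hmax h8 (hftA h8) h9
    have h11 : c - 1 ∈ NF := Finset.mem_filter.2
      ⟨Finset.mem_Ico.2 ⟨by omega, by omega⟩, by rw [h10]; exact h9⟩
    by_contra hcon
    have h12 : c - 1 ∈ Ad := Finset.mem_filter.2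
      ⟨h11, fun h => hcon (Finset.mem_filter.2 ⟨h11, h⟩)⟩
    obtain ⟨g1, -, -, -, -, g2⟩ := hAdmem h12
    rw [h10] at g2
    obtain ⟨r', hr', hr'A⟩ := hthree (mx c) (c - 1 - 1) g2
      (by rwa [show c - 1 - 1 + 1 = c - 1 by omega]) (by rwa [show c - 1 - 1 + 2 = c by omega])
    rw [show c - 1 - 1 + 1 = c - 1 by omega] at hr'A
    have g3 := hmxle hr'A
    have g4 := hmnle hr'A
    omega
  have hAd₂img : (Ad₂.image fun c => c - 1).card = Ad₂.card := by
    refine Finset.card_image_of_injOn fun c hc c' hc' h => ?_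
    have h1 := hAdmem (Finset.mem_filter.1 hc).1
    have h2 := hAdmem (Finset.mem_filter.1 hc').1
    replace h : c - 1 = c' - 1 := h
    omega
  rcases Nat.lt_or_ge k N with hN | hN
  swap
  · have : A = ∅ := Finset.eq_empty_of_forall_notMem fun p hp => by
      have := hA p hp
      omega
    rw [this, Finset.card_empty]
    omega
  have hxA := hmnA (N - 1) (by omega) (by omega)
  set x := mn (N - 1) with hx
  -- The last column saves one. Either its top row starts there, so that row contributes nothing to
  -- `Ad₁`, or the column is in `R` by `hlast` but precedes no column of `Ad₂`.
  have hmiss : (ft x = N - 1 ∧ x ∉ Ad₁.image mx) ∨ Ad₂.card + 1 ≤ R.card := by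
    by_cases hfx : ft x = N - 1
    · refine Or.inl ⟨hfx, fun hmem => ?_⟩
      obtain ⟨c, hc, hcx⟩ := Finset.mem_image.1 hmem
      obtain ⟨h1, h2⟩ := Finset.mem_filter.1 hc
      have := hAdmem h1
      rw [hcx] at h2
      omega
    · right
      have h1 : ft x < N - 1 := lt_of_le_of_ne (hftle hxA) hfx
      have h2 : mx (N - 1) = x := hmax hxA (hftA hxA) h1
      have h3 : N - 1 ∈ NF := Finset.mem_filter.2
        ⟨Finset.mem_Ico.2 ⟨by omega, by omega⟩, by rw [h2]; exact h1⟩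
      have h4 : N - 1 ∈ R := by
        by_contra hcon
        have h5 : N - 1 ∈ Ad := Finset.mem_filter.2
          ⟨h3, fun h => hcon (Finset.mem_filter.2 ⟨h3, h⟩)⟩
        obtain ⟨g1, -, -, -, -, g2⟩ := hAdmem h5
        rw [h2] at g2
        obtain ⟨r', hr', hr'A⟩ := hlast x (N - 1 - 1) g2
          (by rwa [show N - 1 - 1 + 1 = N - 1 by omega]) (by omega)
        rw [show N - 1 - 1 + 1 = N - 1 by omega] at hr'A
        have g3 := hmxle hr'A
        have g4 := hmnle hr'A
        omega
      rw [← hAd₂img]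
      refine Finset.card_lt_card ⟨hAd₂sub, fun hsub => ?_⟩
      obtain ⟨c, hc, hcN⟩ := Finset.mem_image.1 (hsub h4)
      have := hAdmem (Finset.mem_filter.1 hc).1
      omega
  have hAd₁card : Ad₁.card ≤ Rw.card := hAd₁img ▸ Finset.card_le_card hAd₁sub
  have hAd₂card : Ad₂.card ≤ R.card := hAd₂img ▸ Finset.card_le_card hAd₂sub
  have hcard₁ : Ad.card + 1 ≤ Rw.card + R.card := by
    rcases hmiss with ⟨-, hmiss⟩ | hmiss
    · have : Ad₁.card + 1 ≤ Rw.card := by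
        rw [← hAd₁img]
        exact Finset.card_lt_card ⟨hAd₁sub, fun hsub => hmiss (hsub (hRwmem hxA))⟩
      omega
    · omega
  -- `R.card` enters the bound twice, so `R.card < k - 1` already saves enough. Otherwise every row
  -- except the last is a value `mn (c - 1)` on `R`.
  rcases Nat.lt_or_ge R.card (k - 1) with hlt | hge
  · omega
  have hReq : R.image (fun c => mn (c - 1)) = Finset.range (k - 1) :=
    Finset.eq_of_subset_of_card_le hRsub (by rw [Finset.card_range, hRimg]; exact hge)
  -- If the last row started at a later column `f`, then `mn (f - 1)` would be attained on `R`, by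
  -- `hup` only at `f` itself. But the lowest entry of column `f` is first in its row, so `f` is not
  -- in `NF`. If the last row were empty, `R` would have too few values.
  have hb : (k - 1, k) ∈ A := by
    by_contra hb
    by_cases hbRw : k - 1 ∈ Rw
    · obtain ⟨⟨b, c⟩, hbc, hbk⟩ := Finset.mem_image.1 hbRw
      simp only at hbk
      subst hbk
      have h1 := hftA hbc
      have h2 := hA _ h1
      simp only at h2
      have h3 : k < ft (k - 1) := lt_of_le_of_ne h2.2.1 fun h => hb (by rwa [← h] at h1)
      have h4 : mx (ft (k - 1)) = k - 1 := by
        have h5 := hmxle h1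
        have h6 := (hA _ (hmxA _ h2.2.1 h2.2.2)).1
        simp only at h6
        omega
      have h5 := hmnA (ft (k - 1) - 1) (by omega) (by omega)
      have h6 : mn (ft (k - 1) - 1) < k - 1 := by
        have h7 := (hA _ h5).1
        simp only at h7
        rcases Nat.lt_or_ge (mn (ft (k - 1) - 1)) (k - 1) with h8 | h8
        · exact h8
        · have h9 : mn (ft (k - 1) - 1) = k - 1 := by omega
          rw [h9] at h5
          have := hftle h5
          omega
      have h7 : mn (ft (k - 1) - 1) ∈ R.image (fun c => mn (c - 1)) := by
        rw [hReq]; exact Finset.mem_range.2 h6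
      obtain ⟨d, hd, hde⟩ := Finset.mem_image.1 h7
      obtain ⟨g1, g2, g3, -⟩ := hRmem hd
      have h8 : d = ft (k - 1) := le_antisymm
        (hup h3 h2.2.2 g1 g2 (by rw [h4]; exact h6) hde.symm) (hup g1 g2 h3 h2.2.2 g3 hde)
      have h9 := (hNFmem (Finset.mem_filter.1 hd).1).2.2.2
      rw [h8, h4] at h9
      exact lt_irrefl _ h9
    · have : R.image (fun c => mn (c - 1)) ⊆ Finset.range (k - 2) := by
        intro y hy
        obtain ⟨c, hc, rfl⟩ := Finset.mem_image.1 hy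
        obtain ⟨h1, h2, h3, h4⟩ := hRmem hc
        have h5 : mx c ≠ k - 1 := fun h => hbRw (h ▸ hRwmem (hmxA c h1.le h2))
        exact Finset.mem_range.2 (by omega)
      rw [hReq] at this
      have := Finset.card_le_card this
      simp only [Finset.card_range] at this
      omega
  have hftb : ft (k - 1) = k := le_antisymm (hftle hb) (hA _ (hftA hb)).2.1
  -- By `hfirst`, the last row is missing from `Ad₁` too. This is the second saving.
  have hbAd : k - 1 ∉ Ad₁.image mx := by
    intro hmem
    obtain ⟨c, hc, hcb⟩ := Finset.mem_image.1 hmem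
    obtain ⟨h1, h2⟩ := Finset.mem_filter.1 hc
    obtain ⟨h3, h4, h5, h6, h7, h8⟩ := hAdmem h1
    rw [hcb] at h2 h5 h7
    obtain rfl : c = k + 1 := by omega
    obtain ⟨r', hr', hr'A⟩ := hfirst hb h5
    have g1 := hmnle hr'A
    have g2 := (hA _ hr'A).1
    rw [Nat.add_sub_cancel] at h7
    simp only at g2
    omega
  rcases hmiss with ⟨hfx, hmiss⟩ | hmiss
  · have hxb : x ≠ k - 1 := by
      intro hxb
      rw [hxb, hftb] at hfx
      obtain ⟨c, hc⟩ : R.Nonempty := Finset.card_pos.1 (by omega)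
      have := hRmem hc
      omega
    have : Ad₁.card + 2 ≤ Rw.card := by
      have hsub : insert x (insert (k - 1) (Ad₁.image mx)) ⊆ Rw := by
        intro y hy
        rcases Finset.mem_insert.1 hy with rfl | hy
        · exact hRwmem hxA
        rcases Finset.mem_insert.1 hy with rfl | hy
        · exact hRwmem hb
        · exact hAd₁sub hy
      have hc := Finset.card_le_card hsub
      rw [Finset.card_insert_of_notMem (by
          rw [Finset.mem_insert]
          exact fun h => h.elim hxb hmiss),
        Finset.card_insert_of_notMem hbAd, hAd₁img] at hc
      omega
    omega
  · have : Ad₁.card + 1 ≤ Rw.card := by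
      rw [← hAd₁img]
      exact Finset.card_lt_card ⟨hAd₁sub, fun hsub => hbAd (hsub (hRwmem hb))⟩
    omega

/-! ### Bounds on edges and vertices -/

namespace OrderedGraph

theorem IsBipartiteSplit.of_mem_edgePairs {G : OrderedGraph} {a b : ℕ} (h : G.IsBipartiteSplit a b)
    {p : ℕ × ℕ} (hp : p ∈ G.edgePairs) : p.1 < a ∧ a ≤ p.2 ∧ p.2 < a + b := by
  obtain ⟨u, v, huv, hadj, rfl⟩ := exists_of_mem_edgePairs hp
  obtain ⟨h1, h2⟩ := h.2 u v huv hadj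
  exact ⟨h1, h2, h.1 ▸ v.2⟩

theorem IsMinimallyNonlinear.not_contains {G P : OrderedGraph} (h : G.IsMinimallyNonlinear)
    (hP : ¬ P.HasLinearBound) (hne : P ≠ G) : ¬ G.Contains P :=
  fun hc => hP (h.2 P hc hne).hasLinearBound

/-- With at most one row, the last two columns would share their only neighbour, against
`exists_of_last`. So there are at most two vertices in all. -/
theorem IsMinimallyNonlinear.two_le {G : OrderedGraph} (h : G.IsMinimallyNonlinear) {k l : ℕ}
    (hs : G.IsBipartiteSplit k l) : 2 ≤ k := by
  by_contra! hk
  have hrow : ∀ c, k ≤ c → c < k + l → k = 1 ∧ (0, c) ∈ G.edgePairs := by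
    intro c h1 h2
    obtain ⟨r, hr⟩ := h.exists_neighbor hs h1 h2
    have := (hs.of_mem_edgePairs hr).1
    simp only at this
    obtain rfl : r = 0 := by omega
    exact ⟨by omega, hr⟩
  have hl : l < 2 := by
    by_contra! hl
    obtain ⟨hk1, h1⟩ := hrow (k + l - 2) (by omega) (by omega)
    obtain ⟨-, h2⟩ := hrow (k + l - 2 + 1) (by omega) (by omega)
    obtain ⟨r', hr', hr | hr⟩ := h.exists_of_last h1 h2 (by rw [hs.1]; omega)
    · have := (hs.of_mem_edgePairs hr).1
      simp only at this
      omega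
    · have := (hs.of_mem_edgePairs hr).1
      simp only at this
      omega
  refine (hasLinearBound_of_order_le_two ?_).not_isNonlinear h.1
  rw [hs.1]
  omega

/-- A minimally non-linear bipartite ordered graph with `k` vertices in the first part has at most
`4k - 4` edges. -/
theorem IsMinimallyNonlinear.numEdges_add_four_le {G : OrderedGraph} (h : G.IsMinimallyNonlinear)
    {k l : ℕ} (hs : G.IsBipartiteSplit k l) : G.numEdges + 4 ≤ 4 * k := by
  have hk := h.two_le hs
  rw [numEdges_eq_card]
  by_cases hz : zigzag = G
  · subst hz
    have : zigzag.edgePairs.card = 3 := by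
      rw [zigzag, edgePairs_ofPairs isHost_zigzag]; rfl
    omega
  by_cases hi : interleaved = G
  · subst hi
    have : interleaved.edgePairs.card = 3 := by
      rw [interleaved, edgePairs_ofPairs isHost_interleaved]; rfl
    omega
  have hz := h.not_contains not_hasLinearBound_zigzag hz
  have hi := h.not_contains not_hasLinearBound_interleaved hi
  have hside : ∀ {r c r'}, (r, c) ∈ G.edgePairs → (c, r') ∉ G.edgePairs := by
    intro r c r' h1 h2
    have h1 := hs.of_mem_edgePairs h1
    have h2 := hs.of_mem_edgePairs h2
    simp only at h1 h2
    omega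
  refine card_le_of_irredundant (N := k + l) hk (fun p hp => hs.of_mem_edgePairs hp)
    (fun c h1 h2 => h.exists_neighbor hs h1 h2) ?_ ?_ ?_ ?_
  · intro r s a b c hrs ha hc hab hbc hb
    have h1 := (hs.of_mem_edgePairs ha).2.1
    have h2 := (hs.of_mem_edgePairs hb).1
    simp only at h1 h2
    rcases hbc.eq_or_lt with rfl | hbc
    · exact hz (contains_zigzag hrs (by omega) hab ha hc hb)
    · exact hi (contains_interleaved hrs (by omega) hab hbc ha hc hb)
  · intro r c h1 h2 h3
    obtain ⟨r', hr', hr | hr⟩ := h.exists_of_three h1 h2 h3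
    · exact ⟨r', hr', hr⟩
    · exact absurd hr (hside h2)
  · intro r c h1 h2 h3
    obtain ⟨r', hr', hr | hr⟩ := h.exists_of_last h1 h2 (by rw [hs.1, h3])
    · exact ⟨r', hr', hr⟩
    · exact absurd hr (hside h2)
  · obtain ⟨r, rfl⟩ : ∃ r, k = r + 1 := ⟨k - 1, by omega⟩
    intro h1 h2
    rw [Nat.add_sub_cancel] at h1 h2 ⊢
    obtain ⟨r', hr', hr | hr⟩ := h.exists_of_first h1 h2
    · exact ⟨r', hr', hr⟩
    · exact absurd hr (hside h1)

theorem IsMinimallyNonlinear.le_numEdges {G : OrderedGraph} (h : G.IsMinimallyNonlinear)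
    {k l : ℕ} (hs : G.IsBipartiteSplit k l) : l ≤ G.numEdges := by
  rw [numEdges_eq_card]
  calc l = (Finset.Ico k (k + l)).card := by simp
    _ ≤ (G.edgePairs.image Prod.snd).card := Finset.card_le_card fun c hc => by
        obtain ⟨h1, h2⟩ := Finset.mem_Ico.1 hc
        obtain ⟨r, hr⟩ := h.exists_neighbor hs h1 h2
        exact Finset.mem_image.2 ⟨_, hr, rfl⟩
    _ ≤ G.edgePairs.card := Finset.card_image_le

theorem IsMinimallyNonlinear.bounds_of_hasParts {G : OrderedGraph} (h : G.IsMinimallyNonlinear)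
    {k l : ℕ} (hp : G.HasParts k l) : G.numEdges + 4 ≤ 4 * k ∧ l + 4 ≤ 4 * k := by
  rcases hp with hs | hs
  · have h1 := h.numEdges_add_four_le hs
    have h2 := h.le_numEdges hs
    omega
  · have h1 := h.reverse.numEdges_add_four_le hs.reverse
    have h2 := h.reverse.le_numEdges hs.reverse
    rw [numEdges_reverse] at h1 h2
    omega

end OrderedGraph

/-! ### Counting lists of sets, and the numerical estimate -/

theorem one_add_two_div_pow_le (k : ℕ) (hk : 0 < k) : (1 + 2 / (3 * k) : ℝ) ^ k ≤ 2 := by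
  have hk' : (0 : ℝ) < k := by exact_mod_cast hk
  have h1 : (1 + 2 / (3 * k) : ℝ) ≤ Real.exp (2 / (3 * k)) := by
    rw [add_comm]; exact Real.add_one_le_exp _
  calc (1 + 2 / (3 * k) : ℝ) ^ k ≤ Real.exp (2 / (3 * k)) ^ k := by gcongr
    _ = Real.exp (2 / 3) := by
        rw [← Real.exp_nat_mul]
        congr 1
        field_simp
    _ ≤ 2 := by
        rw [← Real.le_log_iff_exp_le two_pos]
        have := Real.log_two_gt_d9
        linarith

/-- The number of sequences of non-empty subsets of a `k`-set of total size `e` is at most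
`(3k/2) ^ e`. -/
theorem card_lists_of_sum_eq_le {k : ℕ} (hk : 0 < k) (e : ℕ) (F : Finset (List (Finset ℕ)))
    (hF : ∀ x ∈ F, (∀ s ∈ x, s.Nonempty ∧ s ⊆ Finset.range k) ∧ (x.map Finset.card).sum = e) :
    (F.card : ℝ) ≤ (3 * k / 2 : ℝ) ^ e := by
  induction e using Nat.strong_induction_on generalizing F with | _ e ih
  have hk' : (0 : ℝ) < k := by exact_mod_cast hk
  set C : ℝ := 3 * k / 2 with hC
  have hC0 : 0 < C := by positivity
  rcases Nat.eq_zero_or_pos e with rfl | he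
  · have : F ⊆ {[]} := by
      intro x hx
      obtain ⟨h1, h2⟩ := hF x hx
      cases x with
      | nil => simp
      | cons s t =>
        have h3 := (h1 s (by simp)).1.card_pos
        simp only [List.map_cons, List.sum_cons] at h2
        omega
    simpa using Finset.card_le_card this
  set P := (Finset.range k).powerset.erase ∅ with hP
  set Fs : Finset ℕ → Finset (List (Finset ℕ)) := fun s => (F.filter fun x => x.head? = some s).image
    List.tail with hFs
  have hmem : ∀ {s t}, t ∈ Fs s → s :: t ∈ F := by
    intro s t ht
    obtain ⟨x, hx, rfl⟩ := Finset.mem_image.1 ht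
    obtain ⟨h1, h2⟩ := Finset.mem_filter.1 hx
    cases x with
    | nil => simp at h2
    | cons a b =>
      simp only [List.head?_cons, Option.some.injEq] at h2
      subst h2
      exact h1
  have hsub : F ⊆ P.biUnion fun s => (Fs s).image (s :: ·) := by
    intro x hx
    obtain ⟨h1, h2⟩ := hF x hx
    cases x with
    | nil => simp only [List.map_nil, List.sum_nil] at h2; omega
    | cons s t =>
      obtain ⟨h3, h4⟩ := h1 s (by simp)
      refine Finset.mem_biUnion.2 ⟨s, Finset.mem_erase.2 ⟨h3.ne_empty, Finset.mem_powerset.2 h4⟩,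
        Finset.mem_image.2 ⟨t, Finset.mem_image.2 ⟨s :: t, Finset.mem_filter.2 ⟨hx, rfl⟩, rfl⟩, rfl⟩⟩
  have hcard : F.card ≤ ∑ s ∈ P, (Fs s).card :=
    (Finset.card_le_card hsub).trans (Finset.card_biUnion_le.trans
      (Finset.sum_le_sum fun s _ => Finset.card_image_le))
  have hbound : ∀ s ∈ P, ((Fs s).card : ℝ) ≤ C ^ e * (1 / C) ^ s.card := by
    intro s hs
    have hpos : 0 < s.card := Finset.card_pos.2
      (Finset.nonempty_iff_ne_empty.2 (Finset.ne_of_mem_erase hs))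
    rcases Nat.lt_or_ge e s.card with hlt | hge
    · have : Fs s = ∅ := Finset.eq_empty_of_forall_notMem fun t ht => by
        have := (hF _ (hmem ht)).2
        simp only [List.map_cons, List.sum_cons] at this
        omega
      rw [this, Finset.card_empty, Nat.cast_zero]
      positivity
    · have h1 := ih (e - s.card) (by omega) (Fs s) fun t ht => by
        obtain ⟨h1, h2⟩ := hF _ (hmem ht)
        simp only [List.map_cons, List.sum_cons] at h2
        exact ⟨fun a ha => h1 a (List.mem_cons_of_mem _ ha), by omega⟩
      refine h1.trans_eq ?_
      rw [one_div, inv_pow, ← div_eq_mul_inv, eq_div_iff (by positivity), ← pow_add]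
      congr 1
      omega
  -- Splitting off the first set closes the induction because these weights sum to `(1 + 1 / C) ^ k
  -- - 1 ≤ exp (2 / 3) - 1 ≤ 1`, which is the reason for `C = 3 * k / 2`.
  have hsum : ∑ s ∈ P, (1 / C) ^ s.card ≤ 1 := by
    have h1 := Finset.sum_pow_mul_eq_add_pow (1 / C) 1 (Finset.range k)
    have h2 := Finset.add_sum_erase (Finset.range k).powerset (fun s => (1 / C) ^ s.card)
      (Finset.empty_mem_powerset _)
    simp only [one_pow, mul_one, Finset.card_range] at h1
    rw [h1, Finset.card_empty, pow_zero] at h2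
    have h3 := one_add_two_div_pow_le k hk
    have h4 : 1 / C + 1 = 1 + 2 / (3 * k) := by
      rw [hC, one_div_div]
      ring
    rw [h4] at h2
    linarith
  calc (F.card : ℝ) ≤ ((∑ s ∈ P, (Fs s).card : ℕ) : ℝ) := by exact_mod_cast hcard
    _ = ∑ s ∈ P, ((Fs s).card : ℝ) := by push_cast; rfl
    _ ≤ ∑ s ∈ P, C ^ e * (1 / C) ^ s.card := Finset.sum_le_sum hbound
    _ = C ^ e * ∑ s ∈ P, (1 / C) ^ s.card := by rw [Finset.mul_sum]
    _ ≤ C ^ e * 1 := by gcongr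
    _ = C ^ e := mul_one _

theorem card_lists_of_sum_le_le {k : ℕ} (hk : 0 < k) (m : ℕ) (F : Finset (List (Finset ℕ)))
    (hF : ∀ x ∈ F, (∀ s ∈ x, s.Nonempty ∧ s ⊆ Finset.range k) ∧ (x.map Finset.card).sum ≤ m) :
    (F.card : ℝ) ≤ ∑ e ∈ Finset.range (m + 1), (3 * k / 2 : ℝ) ^ e := by
  have h1 := Finset.card_eq_sum_card_fiberwise (s := F) (t := Finset.range (m + 1))
    (f := fun x => (x.map Finset.card).sum)
    (fun x hx => Finset.mem_coe.2 (Finset.mem_range.2 (Nat.lt_succ_of_le (hF x hx).2)))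
  rw [h1]
  push_cast
  refine Finset.sum_le_sum fun e _ => card_lists_of_sum_eq_le hk e _ fun x hx => ?_
  obtain ⟨h2, h3⟩ := Finset.mem_filter.1 hx
  exact ⟨(hF x h2).1, h3⟩

theorem pow_add_mul_pow_le (b : ℤ) (hb : 0 ≤ b) (j : ℕ) :
    b ^ (j + 1) + (j + 1) * b ^ j ≤ (b + 1) ^ (j + 1) := by
  induction j with
  | zero => simp
  | succ j ih =>
    have h1 : 0 ≤ (j + 1) * b ^ j := by positivity
    calc b ^ (j + 1 + 1) + ((j + 1 : ℕ) + 1) * b ^ (j + 1)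
        ≤ (b ^ (j + 1) + (j + 1) * b ^ j) * (b + 1) := by
          push_cast
          have : (b ^ (j + 1) + (j + 1) * b ^ j) * (b + 1) =
            b ^ (j + 1 + 1) + ((j + 1) + 1) * b ^ (j + 1) + (j + 1) * b ^ j := by ring
          linarith
      _ ≤ (b + 1) ^ (j + 1) * (b + 1) := by gcongr
      _ = (b + 1) ^ (j + 1 + 1) := by ring

theorem sum_range_pow_le {C : ℝ} (hC : 6 ≤ C) (n : ℕ) :
    ∑ e ∈ Finset.range (n + 1), C ^ e ≤ 6 / 5 * C ^ n := by
  induction n with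
  | zero => norm_num
  | succ n ih =>
    rw [Finset.sum_range_succ, pow_succ]
    have : 0 < C ^ n := by positivity
    nlinarith

/-- For `k = j + 1 ≥ 4` the term `i = 4 * j` suffices. By `pow_add_mul_pow_le` it is at least `k ^
(4 * j) * (4 * j - 1) ^ j`, while the left side is at most `12 / 5 * (3 * k / 2) ^ (4 * j)`. The
comparison rests on `2 * (3 / 2) ^ 4 < 11 ≤ 4 * j - 1`. -/
theorem enumeration_bound {k : ℕ} (hk : 2 < k) :
    2 * ∑ e ∈ Finset.range (4 * k - 4 + 1), (3 * k / 2 : ℝ) ^ e ≤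
      ((∑ i ∈ Finset.Icc ⌈((k : ℚ) + 4) / 4⌉₊ (4 * k - 4),
        ((i : ℤ) ^ k - ((i : ℤ) - 1) ^ k) * (k : ℤ) ^ (i - 1) : ℤ) : ℝ) := by
  have hkQ : (2 : ℚ) < k := by exact_mod_cast hk
  have hsub : ∀ s : Finset ℕ, s ⊆ Finset.Icc ⌈((k : ℚ) + 4) / 4⌉₊ (4 * k - 4) →
      ∑ i ∈ s, ((i : ℤ) ^ k - ((i : ℤ) - 1) ^ k) * (k : ℤ) ^ (i - 1) ≤
      ∑ i ∈ Finset.Icc ⌈((k : ℚ) + 4) / 4⌉₊ (4 * k - 4),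
        ((i : ℤ) ^ k - ((i : ℤ) - 1) ^ k) * (k : ℤ) ^ (i - 1) := by
    intro s hs
    refine Finset.sum_le_sum_of_subset_of_nonneg hs fun i hi _ => ?_
    have h1 : 0 < ⌈((k : ℚ) + 4) / 4⌉₊ := Nat.ceil_pos.2 (by positivity)
    have h2 : (1 : ℤ) ≤ i := by
      have := (Finset.mem_Icc.1 hi).1
      omega
    have h3 : ((i : ℤ) - 1) ^ k ≤ (i : ℤ) ^ k := pow_le_pow_left₀ (by omega) (by omega) k
    exact mul_nonneg (by linarith) (by positivity)
  have hmem : ∀ i, k + 4 ≤ 4 * i → i ≤ 4 * k - 4 →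
      i ∈ Finset.Icc ⌈((k : ℚ) + 4) / 4⌉₊ (4 * k - 4) := by
    intro i h1 h2
    refine Finset.mem_Icc.2 ⟨Nat.ceil_le.2 ?_, h2⟩
    have : (k : ℚ) + 4 ≤ 4 * i := by exact_mod_cast h1
    linarith
  rcases Nat.eq_or_lt_of_le (Nat.succ_le_of_lt hk) with rfl | hk4
  -- For `k = 3` the top term alone is too small, and the top two are enough.
  · have h1 := hsub {7, 8} (by
      intro i hi
      simp only [Finset.mem_insert, Finset.mem_singleton] at hi
      exact hmem i (by omega) (by omega))
    rw [Finset.sum_pair (by norm_num)] at h1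
    refine le_trans ?_ (Int.cast_le.2 h1)
    norm_num [Finset.sum_range_succ]
  · obtain ⟨j, rfl⟩ : ∃ j, k = j + 1 := ⟨k - 1, by omega⟩
    have hj : 3 ≤ j := by omega
    have h1 := hsub {4 * j} (by
      intro i hi
      rw [Finset.mem_singleton] at hi
      exact hmem i (by omega) (by omega))
    rw [Finset.sum_singleton] at h1
    have h2 : ((j + 1 : ℕ) : ℤ) ^ (4 * j) * (4 * j - 1) ^ j ≤
        (((4 * j : ℕ) : ℤ) ^ (j + 1) - (((4 * j : ℕ) : ℤ) - 1) ^ (j + 1)) *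
          ((j + 1 : ℕ) : ℤ) ^ (4 * j - 1) := by
      have h3 := pow_add_mul_pow_le (4 * (j : ℤ) - 1) (by omega) j
      rw [sub_add_cancel] at h3
      obtain ⟨i, hi⟩ : ∃ i, 4 * j = i + 1 := ⟨4 * j - 1, by omega⟩
      rw [show 4 * j - 1 = i by omega]
      conv_lhs => rw [hi, pow_succ]
      push_cast
      have h4 : (0 : ℤ) ≤ ((j : ℤ) + 1) ^ i := by positivity
      nlinarith
    have h3 := h2.trans h1
    rw [show 4 * (j + 1) - 4 = 4 * j by omega] at h3 ⊢
    refine le_trans ?_ (Int.cast_le.2 h3)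
    have hjR : (3 : ℝ) ≤ j := by exact_mod_cast hj
    have h4 := sum_range_pow_le (C := 3 * ((j + 1 : ℕ) : ℝ) / 2) (by push_cast; linarith) (4 * j)
    have h5 : (12 / 5 : ℝ) * (3 / 2) ^ (4 * j) ≤ (4 * j - 1) ^ j := by
      have h6 : (12 / 5 : ℝ) ≤ 2 ^ j := by
        calc (12 / 5 : ℝ) ≤ 2 ^ 3 := by norm_num
          _ ≤ 2 ^ j := pow_le_pow_right₀ (by norm_num) hj
      calc (12 / 5 : ℝ) * (3 / 2) ^ (4 * j) ≤ 2 ^ j * (3 / 2) ^ (4 * j) := by gcongr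
        _ = (2 * (3 / 2) ^ 4) ^ j := by rw [mul_pow, pow_mul]
        _ ≤ (4 * j - 1) ^ j := by
            refine pow_le_pow_left₀ (by norm_num) ?_ j
            norm_num
            linarith
    push_cast at h4 ⊢
    have h6 : (3 * ((j : ℝ) + 1) / 2) ^ (4 * j) = (3 / 2) ^ (4 * j) * ((j : ℝ) + 1) ^ (4 * j) := by
      rw [← mul_pow]; congr 1; ring
    rw [h6] at h4
    have h7 : (0 : ℝ) ≤ ((j : ℝ) + 1) ^ (4 * j) := by positivity
    have h8 := mul_le_mul_of_nonneg_left h5 h7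
    linarith

/-! ### The number of minimally non-linear graphs -/

namespace OrderedGraph

theorem eq_of_edgePairs_eq {G H : OrderedGraph} (h : G.order = H.order)
    (hE : G.edgePairs = H.edgePairs) : G = H := by
  have key : ∀ G : OrderedGraph, ofPairs G.order G.edgePairs = G := by
    rintro ⟨n, g⟩
    simp only [ofPairs, mk.injEq, heq_eq_eq, true_and]
    ext u v
    rw [SimpleGraph.fromRel_adj]
    constructor
    · rintro ⟨-, h | h⟩
      · exact adj_of_mem_edgePairs _ _ h
      · exact (adj_of_mem_edgePairs _ _ h).symm
    · intro h
      refine ⟨h.ne, ?_⟩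
      rcases lt_or_gt_of_ne h.ne with hlt | hlt
      · exact Or.inl (mem_edgePairs (G := ⟨n, g⟩) (u := u) (v := v) |>.2 ⟨hlt, h⟩)
      · exact Or.inr (mem_edgePairs (G := ⟨n, g⟩) (u := v) (v := u) |>.2 ⟨hlt, h.symm⟩)
  rw [← key G, ← key H, h, hE]

/-- The neighbourhoods, among the first `k` vertices, of the remaining vertices. -/
noncomputable def columns (k : ℕ) (G : OrderedGraph) : List (Finset ℕ) :=
  List.ofFn fun i : Fin (G.order - k) => (Finset.range k).filter fun r => (r, k + i) ∈ G.edgePairs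

theorem columns_injOn (k : ℕ) :
    Set.InjOn (columns k) {G : OrderedGraph | ∃ l, G.IsBipartiteSplit k l} := by
  have key : ∀ {G H : OrderedGraph} {l l' : ℕ}, G.IsBipartiteSplit k l → H.IsBipartiteSplit k l' →
      columns k G = columns k H → G.edgePairs ⊆ H.edgePairs := by
    rintro G H l l' hG hH h ⟨r, c⟩ hp
    obtain ⟨h1, h2, h3⟩ := hG.of_mem_edgePairs hp
    simp only at h1 h2 h3
    have hlen := congrArg List.length h
    simp only [columns, List.length_ofFn, hG.1, hH.1] at hlen
    have h4 := congrArg (fun x => x[c - k]?) h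
    simp only [columns, List.getElem?_ofFn] at h4
    rw [dif_pos (by rw [hG.1]; omega), dif_pos (by rw [hH.1]; omega), Option.some.injEq,
      Nat.add_sub_cancel' h2] at h4
    have h5 : r ∈ (Finset.range k).filter fun r => (r, c) ∈ G.edgePairs :=
      Finset.mem_filter.2 ⟨Finset.mem_range.2 h1, hp⟩
    rw [h4] at h5
    exact (Finset.mem_filter.1 h5).2
  rintro G ⟨l, hG⟩ H ⟨l', hH⟩ h
  have hlen := congrArg List.length h
  simp only [columns, List.length_ofFn, hG.1, hH.1] at hlen
  exact eq_of_edgePairs_eq (by rw [hG.1, hH.1]; omega)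
    (subset_antisymm (key hG hH h) (key hH hG h.symm))

theorem sum_card_columns_le (k : ℕ) (G : OrderedGraph) :
    ((columns k G).map Finset.card).sum ≤ G.numEdges := by
  rw [columns, List.map_ofFn, List.sum_ofFn, numEdges_eq_card]
  simp only [Function.comp_apply]
  rw [← Finset.card_sigma]
  refine Finset.card_le_card_of_injOn (fun x => (x.2, k + x.1)) (fun x hx => ?_) ?_
  · exact (Finset.mem_filter.1 (Finset.mem_sigma.1 hx).2).2
  · rintro ⟨i, r⟩ - ⟨j, s⟩ - h
    simp only [Prod.mk.injEq, Nat.add_left_cancel_iff, Fin.val_inj] at h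
    obtain ⟨rfl, rfl⟩ := h
    rfl

theorem card_le_of_split {k : ℕ} (hk : 2 < k) (F : Finset OrderedGraph)
    (hF : ∀ G ∈ F, G.IsMinimallyNonlinear ∧ ∃ l, G.IsBipartiteSplit k l) :
    (F.card : ℝ) ≤ ∑ e ∈ Finset.range (4 * k - 4 + 1), (3 * k / 2 : ℝ) ^ e := by
  classical
  have hinj : Set.InjOn (columns k) (F : Set OrderedGraph) :=
    (columns_injOn k).mono fun G hG => (hF G hG).2
  rw [← Finset.card_image_of_injOn hinj]
  refine card_lists_of_sum_le_le (by omega) _ _ fun x hx => ?_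
  obtain ⟨G, hG, rfl⟩ := Finset.mem_image.1 hx
  obtain ⟨h, l, hs⟩ := hF G hG
  refine ⟨fun s hsx => ?_, ?_⟩
  · rw [columns, List.mem_ofFn] at hsx
    obtain ⟨i, rfl⟩ := hsx
    refine ⟨?_, Finset.filter_subset _ _⟩
    have hi := i.2
    have ho := hs.1
    obtain ⟨r, hr⟩ := h.exists_neighbor hs (c := k + i) (by omega) (by omega)
    exact ⟨r, Finset.mem_filter.2 ⟨Finset.mem_range.2 (hs.of_mem_edgePairs hr).1, hr⟩⟩
  · have h1 := sum_card_columns_le k G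
    have h2 := h.numEdges_add_four_le hs
    omega

theorem card_le_of_hasParts {k : ℕ} (hk : 2 < k) (F : Finset OrderedGraph)
    (hF : ∀ G ∈ F, G.IsMinimallyNonlinear ∧ ∃ l, G.HasParts k l) :
    (F.card : ℤ) ≤ ∑ i ∈ Finset.Icc ⌈((k : ℚ) + 4) / 4⌉₊ (4 * k - 4),
      ((i : ℤ) ^ k - ((i : ℤ) - 1) ^ k) * (k : ℤ) ^ (i - 1) := by
  classical
  have h1 := card_le_of_split hk (F.filter fun G => ∃ l, G.IsBipartiteSplit k l) fun G hG => by
    obtain ⟨h1, h2⟩ := Finset.mem_filter.1 hG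
    exact ⟨(hF G h1).1, h2⟩
  -- Graphs with `k` vertices only in the second part are counted through their reversals, whence
  -- the factor 2 in `enumeration_bound`.
  have h2 := card_le_of_split hk
    ((F.filter fun G => ¬ ∃ l, G.IsBipartiteSplit k l).image reverse) fun G hG => by
      obtain ⟨H, hH, rfl⟩ := Finset.mem_image.1 hG
      obtain ⟨h1, h2⟩ := Finset.mem_filter.1 hH
      obtain ⟨h3, l, h4 | h4⟩ := hF H h1
      · exact absurd ⟨l, h4⟩ h2
      · exact ⟨h3.reverse, l, h4.reverse⟩
  rw [Finset.card_image_of_injective _ fun G H h => by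
    rw [← reverse_reverse G, h, reverse_reverse]] at h2
  have h3 := Finset.card_filter_add_card_filter_not (s := F) fun G => ∃ l, G.IsBipartiteSplit k l
  have h4 : (F.card : ℝ) = ((F.filter fun G => ∃ l, G.IsBipartiteSplit k l).card : ℝ) +
      ((F.filter fun G => ¬ ∃ l, G.IsBipartiteSplit k l).card : ℝ) := by exact_mod_cast h3.symm
  have h5 := enumeration_bound hk
  have h6 : (F.card : ℝ) ≤ ((∑ i ∈ Finset.Icc ⌈((k : ℚ) + 4) / 4⌉₊ (4 * k - 4),
      ((i : ℤ) ^ k - ((i : ℤ) - 1) ^ k) * (k : ℤ) ^ (i - 1) : ℤ) : ℝ) := by linarith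
  exact_mod_cast h6

end OrderedGraph

theorem mainTheorem4 :
    (∀ (G : OrderedGraph) (k l : ℕ), G.IsMinimallyNonlinear → G.HasParts k l →
      (G.numEdges : ℤ) ≤ 4 * (k : ℤ) - 4) ∧
    (∀ (G : OrderedGraph) (k l : ℕ), G.IsMinimallyNonlinear → G.HasParts k l →
      (l : ℤ) ≤ 4 * (k : ℤ) - 4) ∧
    (∀ k : ℕ, 2 < k →
      {G : OrderedGraph | G.IsMinimallyNonlinear ∧ ∃ l, G.HasParts k l}.Finite ∧
      ({G : OrderedGraph | G.IsMinimallyNonlinear ∧ ∃ l, G.HasParts k l}.ncard : ℤ) ≤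
        ∑ i ∈ Finset.Icc ⌈((k : ℚ) + 4) / 4⌉₊ (4 * k - 4),
          ((i : ℤ) ^ k - ((i : ℤ) - 1) ^ k) * (k : ℤ) ^ (i - 1)) := by
  refine ⟨fun G k l h hp => ?_, fun G k l h hp => ?_, fun k hk => ?_⟩
  · have := (h.bounds_of_hasParts hp).1
    omega
  · have := (h.bounds_of_hasParts hp).2
    omega
  · have hfin : {G : OrderedGraph | G.IsMinimallyNonlinear ∧ ∃ l, G.HasParts k l}.Finite := by
      by_contra hinf
      -- An infinite family would have a finite subfamily one larger than the bound allows.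
      obtain ⟨F, hF, hcard⟩ := Set.Infinite.exists_subset_card_eq hinf
        ((∑ i ∈ Finset.Icc ⌈((k : ℚ) + 4) / 4⌉₊ (4 * k - 4),
          ((i : ℤ) ^ k - ((i : ℤ) - 1) ^ k) * (k : ℤ) ^ (i - 1)).toNat + 1)
      have := OrderedGraph.card_le_of_hasParts hk F fun G hG => hF hG
      omega
    refine ⟨hfin, ?_⟩
    rw [Set.ncard_eq_toFinset_card _ hfin]
    exact OrderedGraph.card_le_of_hasParts hk _ fun G hG => by simpa using hG
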